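/- A polytope is the convex hull of a non-empty finite subset of $\mathbb{R}^n$; its dimension is that of its affine hull. For a polytope $P \subset \mathbb{R}^n$ and $c \in \mathbb{R}^n$ let $P^c = \{x \in P : \langle c,x\rangle \ge \langle c,y\rangle \text{ for all } y \in P\}$; these sets are the (non-empty) faces of $P$. The normal cone of $P$ at a face $F$ is $N_FP=\{c : F \subseteq P^c\}$ and the normal fan of $P$ is $\{N_FP : F \text{ a face of } P\}$. Polytopes $P,P' \subset \mathbb{R}^n$ are normally equivalent, $P \simeq P'$, if for every $c$ the affine hulls of $P^c$ and $P'^c$ differ by a translation. A polytope is inscribed if all its vertices lie on a common sphere. The inscribed cone of $P$ is $$\mathrm{InCone}(P) = \{P' \simeq P : P' \text{ an inscribed polytope}\}/\text{translations},$$ regarded as a subset of the real vector space of functions on $\mathbb{R}^n$ modulo linear functions, the class of $P'$ being that of its support function $h_{P'}(c)=\max_{x\in P'}\langle c,x\rangle$; $\dim \mathrm{InCone}(P)$ is the dimension of its linear span. $P$ is normally inscribable if $\mathrm{InCone}(P)\neq\emptyset$. A polytope is simplicial if all its facets are simplices; a $2$-face is odd if it has an odd number of vertices; two $2$-faces are adjacent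 if their intersection is an edge. (1) Let $P \subset \mathbb{R}^n$ be a simplicial polytope of dimension $d \ge 3$. Then $\dim \mathrm{InCone}(P) \le 1$. (2) Let $P \subset \mathbb{R}^n$ be a normally inscribable $3$-dimensional polytope. If $P$ has an odd $2$-face, then $\dim \mathrm{InCone}(P) \le 2$. If $P$ has two adjacent odd $2$-faces, then $\dim \mathrm{InCone}(P) = 1$; moreover, up to homothety there is only one inscribed polytope with the same normal fan as $P$: if $Q,Q'$ are two such polytopes, then $Q' = aQ + t$ for some $a > 0$ and $t \in \mathbb{R}^n$. -/

import Mathlib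

open scoped RealInnerProductSpace

noncomputable section

namespace InscribedCone

universe u

variable {E : Type u} [NormedAddCommGroup E] [InnerProductSpace ℝ E]

/-- A (convex) polytope: the convex hull of a non-empty finite set of points. -/
def IsPolytope (P : Set E) : Prop :=
  ∃ s : Set E, s.Finite ∧ s.Nonempty ∧ P = convexHull ℝ s

/-- The dimension of a (non-empty) set: the dimension of its affine hull. -/
def polyDim (P : Set E) : ℕ :=
  Module.finrank ℝ (affineSpan ℝ P).direction

/-- The vertex set of a polytope. -/
def vertices (P : Set E) : Set E :=
  P.extremePoints ℝ

/-- `maxFace P c` is the face `P^c` of `P` on which the linear function `⟪c, ·⟫` is maximal. -/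
def maxFace (P : Set E) (c : E) : Set E :=
  {x | x ∈ P ∧ ∀ y ∈ P, ⟪c, y⟫ ≤ ⟪c, x⟫}

/-- The (non-empty) faces of a polytope `P`, including `P` itself (take `c = 0`). -/
def IsFace (P F : Set E) : Prop :=
  ∃ c : E, F = maxFace P c

/-- The faces of dimension `k`. -/
def IsFaceOfDim (P : Set E) (k : ℕ) (F : Set E) : Prop :=
  IsFace P F ∧ polyDim F = k

/-- The facets: the faces of codimension one. -/
def IsFacet (P F : Set E) : Prop :=
  IsFace P F ∧ polyDim F + 1 = polyDim P

/-- A simplex: the convex hull of a non-empty finite affinely independent set of points. -/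
def IsSimplex (F : Set E) : Prop :=
  ∃ s : Finset E, s.Nonempty ∧ AffineIndependent ℝ ((↑) : s → E) ∧
    F = convexHull ℝ (s : Set E)

/-- A polytope is simplicial if all its facets are simplices. -/
def IsSimplicial (P : Set E) : Prop :=
  ∀ F, IsFacet P F → IsSimplex F

/-- `F` is an odd 2-face of `P`: a two-dimensional face with an odd number of vertices. -/
def IsOddTwoFace (P F : Set E) : Prop :=
  IsFaceOfDim P 2 F ∧ Odd (vertices F).ncard

/-- A polytope is inscribed if all its vertices lie on one sphere. -/
def IsInscribed (P : Set E) : Prop :=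
  ∃ (z : E) (r : ℝ), vertices P ⊆ Metric.sphere z r

/-- Normal equivalence: for every `c` the affine hulls of `P^c` and `Q^c` differ by a
translation. -/
def NormallyEquivalent (P Q : Set E) : Prop :=
  ∀ c : E, (affineSpan ℝ (maxFace P c)).Parallel (affineSpan ℝ (maxFace Q c))

/-- The normal cone `N_F P`. -/
def normalCone (P F : Set E) : Set E :=
  {c | F ⊆ maxFace P c}

/-- The normal fan of `P`: the collection of the normal cones at all (non-empty) faces. -/
def normalFan (P : Set E) : Set (Set E) :=
  {N | ∃ F, IsFace P F ∧ N = normalCone P F}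

/-- The support function `h_P(c) = max {⟪c, x⟫ : x ∈ P}`. -/
def supportFun (P : Set E) : E → ℝ :=
  fun c => sSup ((fun x => ⟪c, x⟫) '' P)

variable (E) in
/-- The space of linear functions `⟪·, t⟫` on `E`. -/
def linearFuns : Submodule ℝ (E → ℝ) where
  carrier := {f | ∃ t : E, f = fun c => ⟪c, t⟫}
  zero_mem' := ⟨0, by funext c; simp⟩
  add_mem' := by
    rintro f g ⟨s, rfl⟩ ⟨t, rfl⟩
    exact ⟨s + t, by funext c; simp [inner_add_right]⟩
  smul_mem' := by
    rintro a f ⟨t, rfl⟩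
    exact ⟨a • t, by funext c; simp [inner_smul_right]⟩

/-- The translation class of a polytope, as the class of its support function modulo linear
functions. A polytope is determined by its support function, Minkowski addition and dilation
by positive numbers are addition and scalar multiplication of support functions, and
`h_{P + t} = h_P + ⟪·, t⟫`. -/
def translationClass (P : Set E) : (E → ℝ) ⧸ linearFuns E :=
  (linearFuns E).mkQ (supportFun P)

/-- The inscribed cone of `P`: the inscribed polytopes that are normally equivalent to `P`,
modulo translations. -/
def inCone (P : Set E) : Set ((E → ℝ) ⧸ linearFuns E) :=
  {q | ∃ Q : Set E, IsPolytope Q ∧ IsInscribed Q ∧ NormallyEquivalent Q P ∧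
    q = translationClass Q}

/-- `P` is normally inscribable if some inscribed polytope is normally equivalent to it. -/
def NormallyInscribable (P : Set E) : Prop :=
  (inCone P).Nonempty

/-- The dimension of the inscribed cone: the dimension of its linear hull (zero if the cone is
empty). -/
def inConeDim (P : Set E) : Cardinal.{u} :=
  Module.rank ℝ (Submodule.span ℝ (inCone P))

end InscribedCone

end

open InscribedCone

namespace InscribedCone

open Filter Topology

/-! ### Faces, vertices and linear spans of polytopes. -/

section Basics

variable {E : Type*} [NormedAddCommGroup E] [InnerProductSpace ℝ E] {P Q : Set E}

/-! Let `Q` be normally equivalent to `P`. A functional exposing a vertex of `P` exposes a vertex of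
`Q`, which depends only on the vertex of `P`, and corresponding edges are positively parallel
(`NormallyEquivalent.exists_vertexMap_sub`). Since the edge graph is connected
(`IsPolytope.induction_on_edges`), what is known at one vertex spreads to all.

For (1), triangles are rigid. Two edges at a vertex `v` that are neighbours in the vertex figure lie
in a common proper face, hence in a simplex facet, and the triangle they span forces `Q` to scale
them equally. The graph of the vertex figure is connected, so all edges at `v` scale by one factor;
the graph of `P` makes the factor global. The vertices of `Q` are then `l • v + t`, and the
inscribed cone lies on a line.

For (2), let `Q` be inscribed and measure its vertices from the centre of the sphere, projected to
the affine hull of `Q`. The ends of an edge are equidistant from the centre, so their vectors are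
exchanged by the reflection in the linear hyperplane orthogonal to that edge, and this hyperplane
depends only on `P`. Inscribed polytopes thus give elements of the linear space `reflectionSpace P`,
whose elements are determined by their value at a single vertex. Along each edge of a 2-face the
area form of the projections of two elements to its plane changes sign, so on an odd face it
vanishes (`IsPolytope.eq_zero_of_odd`) and the two projections are parallel. As an inscribed
polytope has nonzero component along every edge, one odd face leaves dimension at most two. Two odd
faces sharing an edge leave only the component along that edge, so the elements of two inscribed
polytopes are proportional. -/

theorem isPolytope_convexHull {s : Set E} (hs : s.Finite) (hne : s.Nonempty) :
    IsPolytope (convexHull ℝ s) :=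
  ⟨s, hs, hne, rfl⟩

theorem IsPolytope.isCompact (hP : IsPolytope P) : IsCompact P := by
  obtain ⟨s, hs, -, rfl⟩ := hP
  exact hs.isCompact_convexHull ℝ

theorem IsPolytope.convex (hP : IsPolytope P) : Convex ℝ P := by
  obtain ⟨s, -, -, rfl⟩ := hP
  exact convex_convexHull ℝ s

theorem IsPolytope.nonempty (hP : IsPolytope P) : P.Nonempty := by
  obtain ⟨s, -, hs, rfl⟩ := hP
  exact hs.convexHull

theorem IsPolytope.finite_vertices (hP : IsPolytope P) : (vertices P).Finite := by
  obtain ⟨s, hs, -, rfl⟩ := hP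
  exact hs.subset extremePoints_convexHull_subset

theorem vertices_subset (P : Set E) : vertices P ⊆ P := extremePoints_subset

theorem IsPolytope.convexHull_vertices (hP : IsPolytope P) :
    convexHull ℝ (vertices P) = P := by
  have h := closure_convexHull_extremePoints hP.isCompact hP.convex
  change closure (convexHull ℝ (vertices P)) = P at h
  rwa [(hP.finite_vertices.isClosed_convexHull ℝ).closure_eq] at h

theorem IsPolytope.vertices_nonempty (hP : IsPolytope P) : (vertices P).Nonempty := by
  have h := hP.nonempty
  rw [← hP.convexHull_vertices] at h
  exact convexHull_nonempty_iff.mp h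

theorem IsPolytope.eq_of_vertices_eq (hP : IsPolytope P) (hQ : IsPolytope Q)
    (h : vertices P = vertices Q) : P = Q := by
  rw [← hP.convexHull_vertices, ← hQ.convexHull_vertices, h]

theorem isExposed_maxFace (P : Set E) (c : E) : IsExposed ℝ P (maxFace P c) :=
  fun _ => ⟨innerSL ℝ c, by simp [maxFace]⟩

theorem maxFace_subset (P : Set E) (c : E) : maxFace P c ⊆ P := fun _ hx => hx.1

theorem maxFace_zero (P : Set E) : maxFace P 0 = P := by
  ext x; simp [maxFace]

theorem maxFace_singleton (v c : E) : maxFace {v} c = {v} := by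
  ext x; simp +contextual [maxFace]

theorem inner_eq_of_mem_maxFace {c x y : E} (hx : x ∈ maxFace P c) (hy : y ∈ maxFace P c) :
    ⟪c, x⟫ = ⟪c, y⟫ :=
  le_antisymm (hy.2 x hx.1) (hx.2 y hy.1)

theorem mem_maxFace_of_inner_eq {c x y : E} (hx : x ∈ maxFace P c) (hy : y ∈ P)
    (h : ⟪c, x⟫ ≤ ⟪c, y⟫) : y ∈ maxFace P c :=
  ⟨hy, fun z hz => (hx.2 z hz).trans h⟩

theorem vertices_maxFace (P : Set E) (c : E) :
    vertices (maxFace P c) = maxFace P c ∩ vertices P :=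
  (isExposed_maxFace P c).isExtreme.extremePoints_eq

theorem IsPolytope.maxFace_nonempty (hP : IsPolytope P) (c : E) : (maxFace P c).Nonempty := by
  obtain ⟨x, hx, h⟩ := hP.isCompact.exists_isMaxOn hP.nonempty
    (f := fun y => ⟪c, y⟫) (by fun_prop)
  exact ⟨x, hx, fun y hy => h hy⟩

theorem IsPolytope.isPolytope_maxFace (hP : IsPolytope P) (c : E) :
    IsPolytope (maxFace P c) := by
  have hc : IsCompact (maxFace P c) := (isExposed_maxFace P c).isCompact hP.isCompact
  have hv : Convex ℝ (maxFace P c) := (isExposed_maxFace P c).convex hP.convex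
  have hf : (vertices (maxFace P c)).Finite := by
    rw [vertices_maxFace]; exact hP.finite_vertices.inter_of_right _
  have h := closure_convexHull_extremePoints hc hv
  change closure (convexHull ℝ (vertices (maxFace P c))) = _ at h
  rw [(hf.isClosed_convexHull ℝ).closure_eq] at h
  refine ⟨_, hf, ?_, h.symm⟩
  have := hP.maxFace_nonempty c
  rw [← h] at this
  exact convexHull_nonempty_iff.mp this

theorem IsPolytope.inner_le_of_vertices (hP : IsPolytope P) {c : E} {r : ℝ}
    (h : ∀ p ∈ vertices P, ⟪c, p⟫ ≤ r) {x : E} (hx : x ∈ P) : ⟪c, x⟫ ≤ r := by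
  rw [← hP.convexHull_vertices] at hx
  exact convexHull_min (t := {y | ⟪c, y⟫ ≤ r}) h
    (convex_halfSpace_le (innerSL ℝ c).isLinear r) hx

theorem IsPolytope.mem_maxFace (hP : IsPolytope P) {c x : E} (hx : x ∈ P)
    (h : ∀ p ∈ vertices P, ⟪c, p⟫ ≤ ⟪c, x⟫) : x ∈ maxFace P c :=
  ⟨hx, fun _ hy => hP.inner_le_of_vertices h hy⟩

/-- A face is the convex hull of the vertices that it contains. -/
theorem IsPolytope.maxFace_eq (hP : IsPolytope P) {c : E} {s : Set E}
    (h : maxFace P c ∩ vertices P = s) : maxFace P c = convexHull ℝ s := by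
  rw [← h, ← vertices_maxFace, (hP.isPolytope_maxFace c).convexHull_vertices]

theorem mem_vertices_of_maxFace_eq {v c : E} (h : maxFace P c = {v}) : v ∈ vertices P := by
  have := vertices_maxFace P c
  rw [h, vertices, extremePoints_singleton] at this
  exact (this.subset rfl).2

theorem inner_lt_of_maxFace_eq {v c p : E} (h : maxFace P c = {v}) (hp : p ∈ P) (hpv : p ≠ v) :
    ⟪c, p⟫ < ⟪c, v⟫ := by
  have hv : v ∈ maxFace P c := h ▸ rfl
  refine lt_of_le_of_ne (hv.2 p hp) fun he => hpv ?_
  have : p ∈ maxFace P c := mem_maxFace_of_inner_eq hv hp he.ge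
  rwa [h] at this

theorem IsPolytope.maxFace_eq_singleton (hP : IsPolytope P) {v c : E} (hv : v ∈ vertices P)
    (h : ∀ p ∈ vertices P, p ≠ v → ⟪c, p⟫ < ⟪c, v⟫) : maxFace P c = {v} := by
  rw [← convexHull_singleton (𝕜 := ℝ) v]
  apply hP.maxFace_eq
  have hm : v ∈ maxFace P c := hP.mem_maxFace hv.1 fun p hp => by
    by_cases e : p = v
    · rw [e]
    · exact (h p hp e).le
  ext p
  constructor
  · rintro ⟨h1, h2⟩
    by_contra e
    exact (h p h2 e).not_ge (h1.2 v hv.1)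
  · rintro rfl
    exact ⟨hm, hv⟩

/-- Every vertex of a polytope is an exposed point. -/
theorem IsPolytope.exists_maxFace_eq_singleton [CompleteSpace E] (hP : IsPolytope P) {v : E}
    (hv : v ∈ vertices P) : ∃ c, maxFace P c = {v} := by
  -- An extreme point is not in the hull of the other vertices, and that hull is closed, so
  -- Hahn–Banach separates strictly.
  have h1 : v ∉ convexHull ℝ (vertices P \ {v}) := fun h =>
    (hP.convex.mem_extremePoints_iff_mem_sdiff_convexHull_sdiff.mp hv).2
      (convexHull_mono (Set.sdiff_subset_sdiff_left (vertices_subset P)) h)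
  obtain ⟨f, u, h2, h3⟩ := geometric_hahn_banach_closed_point (convex_convexHull ℝ _)
    ((hP.finite_vertices.sdiff (t := {v})).isClosed_convexHull ℝ) h1
  refine ⟨(InnerProductSpace.toDual ℝ E).symm f, hP.maxFace_eq_singleton hv fun p hp hpv => ?_⟩
  simp only [InnerProductSpace.toDual_symm_apply]
  exact (h2 p (subset_convexHull ℝ _ ⟨hp, hpv⟩)).trans h3

/-- A face of a face is a face. -/
theorem IsPolytope.eventually_maxFace_add (hP : IsPolytope P) (c d : E) :
    ∀ᶠ ε : ℝ in 𝓝[>] 0, maxFace P (c + ε • d) = maxFace (maxFace P c) d := by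
  have hF := hP.isPolytope_maxFace c
  obtain ⟨x, hx⟩ := hF.maxFace_nonempty d
  -- Vertices off the face lose strictly at `ε = 0`, hence for all small `ε`, there being finitely
  -- many.
  have h1 : ∀ᶠ ε : ℝ in 𝓝[>] 0, ∀ p ∈ vertices P, p ∉ maxFace P c →
      ⟪c + ε • d, p⟫ < ⟪c + ε • d, x⟫ := by
    rw [eventually_all_finite hP.finite_vertices]
    intro p hp
    by_cases hpc : p ∈ maxFace P c
    · exact Eventually.of_forall fun _ h => absurd hpc h
    have hlt : ⟪c, p⟫ < ⟪c, x⟫ := by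
      by_contra hge
      exact hpc (mem_maxFace_of_inner_eq hx.1 hp.1 (not_lt.mp hge))
    have hc1 : Continuous fun ε : ℝ => ⟪c + ε • d, p⟫ := by fun_prop
    have hc2 : Continuous fun ε : ℝ => ⟪c + ε • d, x⟫ := by fun_prop
    have := (isOpen_lt hc1 hc2).mem_nhds (x := 0) (by simpa using hlt)
    filter_upwards [mem_nhdsWithin_of_mem_nhds this] with ε hε _ using hε
  filter_upwards [h1, self_mem_nhdsWithin] with ε h2 hε
  replace hε : 0 < ε := hε
  have h3 : ∀ p ∈ maxFace P c, ⟪c + ε • d, p⟫ ≤ ⟪c + ε • d, x⟫ := fun p hp => by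
    have e1 := inner_eq_of_mem_maxFace hp hx.1
    have e2 := mul_le_mul_of_nonneg_left (hx.2 p hp) hε.le
    simp only [inner_add_left, real_inner_smul_left]
    linarith
  have hxm : x ∈ maxFace P (c + ε • d) := hP.mem_maxFace hx.1.1 fun p hp => by
    by_cases hpc : p ∈ maxFace P c
    · exact h3 p hpc
    · exact (h2 p hp hpc).le
  apply (hP.isPolytope_maxFace _).eq_of_vertices_eq (hF.isPolytope_maxFace d)
  rw [vertices_maxFace, vertices_maxFace, vertices_maxFace]
  ext p
  constructor
  · rintro ⟨h4, h5⟩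
    have hpc : p ∈ maxFace P c := by
      by_contra h6
      exact (h2 p h5 h6).not_ge (h4.2 x hx.1.1)
    refine ⟨mem_maxFace_of_inner_eq hx hpc ?_, hpc, h5⟩
    have e1 := inner_eq_of_mem_maxFace hpc hx.1
    have e2 := inner_eq_of_mem_maxFace hxm h4
    simp only [inner_add_left, real_inner_smul_left, e1] at e2
    have : ε * ⟪d, x⟫ = ε * ⟪d, p⟫ := by linarith
    exact (mul_left_cancel₀ hε.ne' this).le
  · rintro ⟨h4, h5, h6⟩
    refine ⟨mem_maxFace_of_inner_eq hxm h6.1 ?_, h6⟩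
    have e1 := inner_eq_of_mem_maxFace h5 hx.1
    have e2 := inner_eq_of_mem_maxFace h4 hx
    simp only [inner_add_left, real_inner_smul_left, e1, e2, le_refl]

theorem inner_eq_zero_of_mem_vectorSpan {A : Set E} {d x : E}
    (h : ∀ p ∈ A, ∀ q ∈ A, ⟪d, p⟫ = ⟪d, q⟫) (hx : x ∈ vectorSpan ℝ A) : ⟪d, x⟫ = 0 := by
  refine Submodule.span_induction ?_ ?_ ?_ ?_ hx
  · rintro _ ⟨p, hp, q, hq, rfl⟩
    simp [inner_sub_right, h p hp q hq]
  · simp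
  · intro x y _ _ hx hy
    rw [inner_add_right, hx, hy, add_zero]
  · intro a x _ hx
    rw [inner_smul_right, hx, mul_zero]

theorem inner_eq_zero_of_mem_vectorSpan_maxFace {c x : E} (hx : x ∈ vectorSpan ℝ (maxFace P c)) :
    ⟪c, x⟫ = 0 :=
  inner_eq_zero_of_mem_vectorSpan (fun _ hp _ hq => inner_eq_of_mem_maxFace hp hq) hx

theorem sub_mem_vectorSpan {A : Set E} {p q : E} (hp : p ∈ A) (hq : q ∈ A) :
    p - q ∈ vectorSpan ℝ A :=
  vsub_mem_vectorSpan ℝ hp hq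

theorem polyDim_eq (P : Set E) : polyDim P = Module.finrank ℝ (vectorSpan ℝ P) := by
  rw [polyDim, direction_affineSpan]

theorem vectorSpan_le_of_sub_mem {A : Set E} {v : E} {M : Submodule ℝ E} (hv : v ∈ A)
    (h : ∀ p ∈ A, p - v ∈ M) : vectorSpan ℝ A ≤ M := by
  rw [vectorSpan_eq_span_vsub_set_right ℝ hv, Submodule.span_le]
  rintro _ ⟨p, hp, rfl⟩
  exact h p hp

/-- The vertices of a polytope determine its linear span. -/
theorem IsPolytope.vectorSpan_le (hP : IsPolytope P) {v : E} {M : Submodule ℝ E}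
    (hv : v ∈ P) (h : ∀ p ∈ vertices P, p - v ∈ M) : vectorSpan ℝ P ≤ M := by
  refine vectorSpan_le_of_sub_mem hv fun p hp => ?_
  rw [← hP.convexHull_vertices] at hp
  have hc : Convex ℝ {x | x - v ∈ M} := by
    intro x hx y hy a b _ _ hab
    have : a • x + b • y - v = a • (x - v) + b • (y - v) := by
      rw [smul_sub, smul_sub, sub_add_sub_comm, ← add_smul, hab, one_smul]
    show a • x + b • y - v ∈ M
    rw [this]
    exact M.add_mem (M.smul_mem _ hx) (M.smul_mem _ hy)
  exact convexHull_min h hc hp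

theorem NormallyEquivalent.vectorSpan_eq (h : NormallyEquivalent Q P) (c : E) :
    vectorSpan ℝ (maxFace Q c) = vectorSpan ℝ (maxFace P c) := by
  simpa [direction_affineSpan] using (h c).direction_eq

theorem vectorSpan_eq_bot_of_eq_singleton {A : Set E} {v : E} (h : A = {v}) :
    vectorSpan ℝ A = ⊥ := by
  rw [h, vectorSpan_singleton]

theorem eq_singleton_of_vectorSpan_eq_bot {A : Set E} {v : E} (hv : v ∈ A)
    (h : vectorSpan ℝ A = ⊥) : A = {v} := by
  refine Set.eq_singleton_iff_unique_mem.mpr ⟨hv, fun x hx => ?_⟩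
  have := sub_mem_vectorSpan hx hv
  rw [h, Submodule.mem_bot] at this
  exact sub_eq_zero.mp this

/-- Three vertices of a convex set on a line coincide in part. -/
theorem eq_zero_or_one_of_vertices {v w : E} {r : ℝ} (hv : v ∈ vertices P) (hw : w ∈ vertices P)
    (hp : v + r • (w - v) ∈ vertices P) (hvw : v ≠ w) : r = 0 ∨ r = 1 := by
  have hs : w - v ≠ 0 := sub_ne_zero.mpr hvw.symm
  by_contra! hr
  -- Of three distinct collinear points one lies strictly between the others and is not extreme; `r`
  -- decides which.
  rcases lt_trichotomy r 0 with h | h | h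
  · have : v ∈ openSegment ℝ (v + r • (w - v)) w := by
      refine ⟨1 / (1 - r), -r / (1 - r), by apply div_pos <;> linarith,
        by apply div_pos <;> linarith, by field_simp [show 1 - r ≠ 0 by linarith]; ring, ?_⟩
      have : 1 - r ≠ 0 := by linarith
      match_scalars <;> field_simp <;> ring
    have := hv.2 hp.1 hw.1 this
    rw [add_eq_left, smul_eq_zero] at this
    exact this.elim hr.1 hs
  · exact hr.1 h
  rcases lt_trichotomy r 1 with h' | h' | h'
  · have : v + r • (w - v) ∈ openSegment ℝ v w :=
      ⟨1 - r, r, by linarith, h, by ring, by module⟩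
    have := hp.2 hv.1 hw.1 this
    rw [eq_comm, add_eq_left, smul_eq_zero] at this
    exact this.elim hr.1 hs
  · exact hr.2 h'
  · have : w ∈ openSegment ℝ v (v + r • (w - v)) := by
      refine ⟨1 - 1 / r, 1 / r, ?_, by positivity, by ring, ?_⟩
      · rw [sub_pos, div_lt_one h]; exact h'
      · match_scalars <;> field_simp
        ring
    exact hvw (hw.2 hv.1 hp.1 this)

end Basics

end InscribedCone

namespace InscribedCone

open Filter Topology

/-! ### Vertex figures and connectedness of the edge graph. -/

section Graph

variable {E : Type*} [NormedAddCommGroup E] [InnerProductSpace ℝ E] {P : Set E}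

/-- Two vertices of `P` that span a face. -/
def IsEdge (P : Set E) (v w : E) : Prop :=
  v ≠ w ∧ v ∈ vertices P ∧ w ∈ vertices P ∧ ∃ c, maxFace P c = convexHull ℝ {v, w}

theorem IsEdge.symm {v w : E} (h : IsEdge P v w) : IsEdge P w v := by
  obtain ⟨h1, h2, h3, c, h4⟩ := h
  exact ⟨h1.symm, h3, h2, c, by rw [h4, Set.pair_comm]⟩

theorem IsPolytope.isEdge_of_maxFace (hP : IsPolytope P) (c : E) {v w : E}
    (h : IsEdge (maxFace P c) v w) : IsEdge P v w := by
  obtain ⟨h1, h2, h3, d, h4⟩ := h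
  rw [vertices_maxFace] at h2 h3
  obtain ⟨ε, hε⟩ := (hP.eventually_maxFace_add c d).exists
  exact ⟨h1, h2.2, h3.2, _, hε.trans h4⟩

/-- The point of the vertex figure of a polytope at `v` in the direction of `p`. -/
noncomputable def figurePoint (b v p : E) : E :=
  ⟪b, v - p⟫⁻¹ • (p - v)

/-- The vertex figure of `P` at the vertex `v` that is exposed by `b`. -/
noncomputable def vertexFigure (P : Set E) (b v : E) : Set E :=
  convexHull ℝ (figurePoint b v '' (vertices P \ {v}))

theorem IsPolytope.isPolytope_vertexFigure (hP : IsPolytope P) (b : E) {v p : E}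
    (hp : p ∈ vertices P) (hpv : p ≠ v) : IsPolytope (vertexFigure P b v) :=
  isPolytope_convexHull ((hP.finite_vertices.sdiff).image _) ⟨_, p, ⟨hp, hpv⟩, rfl⟩

theorem figurePoint_mem {b v p : E} (hp : p ∈ vertices P) (hpv : p ≠ v) :
    figurePoint b v p ∈ vertexFigure P b v :=
  subset_convexHull ℝ _ ⟨p, ⟨hp, hpv⟩, rfl⟩

theorem exists_figurePoint_eq {b v q : E} (hq : q ∈ vertices (vertexFigure P b v)) :
    ∃ p ∈ vertices P, p ≠ v ∧ figurePoint b v p = q := by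
  obtain ⟨p, hp, rfl⟩ := extremePoints_convexHull_subset hq
  exact ⟨p, hp.1, hp.2, rfl⟩

theorem inner_sub_pos_of_maxFace_eq {b v p : E} (hb : maxFace P b = {v}) (hp : p ∈ vertices P)
    (hpv : p ≠ v) : 0 < ⟪b, v - p⟫ := by
  rw [inner_sub_right, sub_pos]
  exact inner_lt_of_maxFace_eq hb hp.1 hpv

theorem smul_figurePoint {b v p : E} (hb : maxFace P b = {v}) (hp : p ∈ vertices P)
    (hpv : p ≠ v) : ⟪b, v - p⟫ • figurePoint b v p = p - v := by
  rw [figurePoint, smul_inv_smul₀ (inner_sub_pos_of_maxFace_eq hb hp hpv).ne']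

/-- Vertices with the same figure point lie on one ray from `v`, and a line contains at most two
vertices. -/
theorem figurePoint_injOn {b v : E} (hb : maxFace P b = {v}) :
    Set.InjOn (figurePoint b v) (vertices P \ {v}) := by
  rintro p ⟨hp, hpv⟩ w ⟨hw, hwv⟩ h
  have hk := inner_sub_pos_of_maxFace_eq hb hp hpv
  have hl := inner_sub_pos_of_maxFace_eq hb hw hwv
  have e : p = v + (⟪b, v - p⟫ * ⟪b, v - w⟫⁻¹) • (w - v) := by
    rw [mul_smul, ← figurePoint, ← h, smul_figurePoint hb hp hpv]; abel
  have hv := mem_vertices_of_maxFace_eq hb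
  have hp' := hp
  rw [e] at hp'
  rcases eq_zero_or_one_of_vertices hv hw hp' (Ne.symm hwv) with h0 | h1
  · rw [h0, zero_smul, add_zero] at e; exact absurd e hpv
  · rw [h1, one_smul] at e; rw [e]; abel

/-- The factor `⟪b, v - p⟫` is positive, so comparing `f` with the level `m` on the vertex figure
amounts to comparing `p` with `v` under `f + m • b`. -/
theorem inner_lift {b v p f : E} {m : ℝ} (hb : maxFace P b = {v}) (hp : p ∈ vertices P)
    (hpv : p ≠ v) : ⟪f + m • b, p⟫ - ⟪f + m • b, v⟫ =
      ⟪b, v - p⟫ * (⟪f, figurePoint b v p⟫ - m) := by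
  rw [mul_sub, ← real_inner_smul_right, smul_figurePoint hb hp hpv]
  simp only [inner_add_left, inner_sub_right, real_inner_smul_left]
  ring

/-- The faces of the vertex figure at `v` come from faces of the polytope through `v`. -/
theorem IsPolytope.maxFace_lift (hP : IsPolytope P) {b v f q : E} (hb : maxFace P b = {v})
    (hq : q ∈ maxFace (vertexFigure P b v) f) :
    maxFace P (f + ⟪f, q⟫ • b) ∩ vertices P =
      insert v {p | p ∈ vertices P ∧ p ≠ v ∧
        figurePoint b v p ∈ maxFace (vertexFigure P b v) f} := by
  have hv := mem_vertices_of_maxFace_eq hb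
  have hm : v ∈ maxFace P (f + ⟪f, q⟫ • b) := hP.mem_maxFace hv.1 fun p hp => by
    by_cases e : p = v
    · rw [e]
    rw [← sub_nonpos, inner_lift hb hp e]
    exact mul_nonpos_of_nonneg_of_nonpos (inner_sub_pos_of_maxFace_eq hb hp e).le
      (sub_nonpos.mpr (hq.2 _ (figurePoint_mem hp e)))
  ext p
  simp only [Set.mem_inter_iff, Set.mem_insert_iff, Set.mem_ofPred_eq]
  constructor
  · rintro ⟨h1, h2⟩
    by_cases e : p = v
    · exact Or.inl e
    refine Or.inr ⟨h2, e, mem_maxFace_of_inner_eq hq (figurePoint_mem h2 e) ?_⟩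
    have h3 := inner_lift (f := f) (m := ⟪f, q⟫) hb h2 e
    rw [inner_eq_of_mem_maxFace h1 hm, sub_self, eq_comm, mul_eq_zero] at h3
    linarith [h3.resolve_left (inner_sub_pos_of_maxFace_eq hb h2 e).ne']
  · rintro (rfl | ⟨h2, e, h3⟩)
    · exact ⟨hm, hv⟩
    refine ⟨mem_maxFace_of_inner_eq hm h2.1 ?_, h2⟩
    have h4 := inner_lift (f := f) (m := ⟪f, q⟫) hb h2 e
    rw [inner_eq_of_mem_maxFace h3 hq, sub_self, mul_zero] at h4
    linarith

variable [CompleteSpace E]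

/-- The vertices of the vertex figure at `v` come from edges at `v`. -/
theorem IsPolytope.isEdge_of_figurePoint (hP : IsPolytope P) {b v w : E}
    (hb : maxFace P b = {v}) (hw : w ∈ vertices P) (hwv : w ≠ v)
    (hq : figurePoint b v w ∈ vertices (vertexFigure P b v)) : IsEdge P v w := by
  obtain ⟨f, hf⟩ := (hP.isPolytope_vertexFigure b hw hwv).exists_maxFace_eq_singleton hq
  refine ⟨hwv.symm, mem_vertices_of_maxFace_eq hb, hw, f + ⟪f, figurePoint b v w⟫ • b,
    hP.maxFace_eq ?_⟩
  rw [hP.maxFace_lift hb (hf ▸ rfl), hf]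
  congr 1
  ext p
  constructor
  · rintro ⟨h1, h2, h3⟩
    exact figurePoint_injOn hb ⟨h1, h2⟩ ⟨hw, hwv⟩ h3
  · rintro rfl
    exact ⟨hw, hwv, rfl⟩

/-- At a vertex that is not optimal there is an improving edge. -/
theorem IsPolytope.exists_isEdge_inner_lt (hP : IsPolytope P) {v c : E} (hv : v ∈ vertices P)
    (hc : v ∉ maxFace P c) : ∃ w, IsEdge P v w ∧ ⟪c, v⟫ < ⟪c, w⟫ := by
  obtain ⟨b, hb⟩ := hP.exists_maxFace_eq_singleton hv
  have : ∃ p ∈ vertices P, ⟪c, v⟫ < ⟪c, p⟫ := by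
    by_contra! h
    exact hc (hP.mem_maxFace hv.1 h)
  obtain ⟨p, hp, hpc⟩ := this
  have hpv : p ≠ v := by rintro rfl; exact hpc.false
  have hN := hP.isPolytope_vertexFigure b hp hpv
  -- The improving vertex `p` makes `c` positive somewhere on the vertex figure, hence at a vertex
  -- maximizing `c` there; such a vertex is an edge direction.
  obtain ⟨q, hq⟩ := (hN.isPolytope_maxFace c).vertices_nonempty
  rw [vertices_maxFace] at hq
  obtain ⟨w, hw, hwv, rfl⟩ := exists_figurePoint_eq hq.2
  refine ⟨w, hP.isEdge_of_figurePoint hb hw hwv hq.2, ?_⟩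
  have h1 := hq.1.2 _ (figurePoint_mem hp hpv)
  have e1 := inner_lift (f := c) (m := 0) hb hp hpv
  have e2 := inner_lift (f := c) (m := 0) hb hw hwv
  simp only [zero_smul, add_zero, sub_zero] at e1 e2
  have h2 : 0 < ⟪c, figurePoint b v p⟫ :=
    pos_of_mul_pos_right (e1 ▸ sub_pos.mpr hpc) (inner_sub_pos_of_maxFace_eq hb hp hpv).le
  rw [← sub_pos, e2]
  exact mul_pos (inner_sub_pos_of_maxFace_eq hb hw hwv) (h2.trans_le h1)

/-- The graph of a polytope is connected. -/
theorem IsPolytope.induction_on_edges (hP : IsPolytope P) {S : E → Prop} {v₀ : E}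
    (hv₀ : v₀ ∈ vertices P) (h₀ : S v₀) (h : ∀ v w, IsEdge P v w → S v → S w) {w : E}
    (hw : w ∈ vertices P) : S w := by
  obtain ⟨c, hc⟩ := hP.exists_maxFace_eq_singleton hw
  -- With `c` exposing the target `w`, take the best vertex satisfying `S`: an improving edge would
  -- lead to a better one.
  obtain ⟨v, ⟨hv, hSv⟩, hmax⟩ := Set.exists_max_image {v | v ∈ vertices P ∧ S v} (fun v => ⟪c, v⟫)
    (hP.finite_vertices.subset fun _ h => h.1) ⟨v₀, hv₀, h₀⟩
  by_cases hvc : v ∈ maxFace P c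
  · rw [hc] at hvc
    rwa [← Set.mem_singleton_iff.mp hvc]
  · obtain ⟨u, hu, hlt⟩ := hP.exists_isEdge_inner_lt hv hvc
    exact absurd (hmax u ⟨hu.2.2.1, h v u hu hSv⟩) (not_le.mpr hlt)

theorem IsPolytope.exists_isEdge (hP : IsPolytope P) {v p : E} (hv : v ∈ vertices P)
    (hp : p ∈ P) (hpv : p ≠ v) : ∃ w, IsEdge P v w := by
  obtain ⟨w, hw, -⟩ := hP.exists_isEdge_inner_lt hv (c := p - v) fun h => by
    have := h.2 p hp
    have h2 : 0 < ⟪p - v, p - v⟫ := real_inner_self_pos.mpr (sub_ne_zero.mpr hpv)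
    rw [inner_sub_right] at h2
    linarith
  exact ⟨w, hw⟩

end Graph

end InscribedCone

namespace InscribedCone

open Filter Topology

/-! ### Corresponding vertices and edges of normally equivalent polytopes. -/

section Correspondence

variable {E : Type*} [NormedAddCommGroup E] [InnerProductSpace ℝ E] {P Q : Set E}

theorem NormallyEquivalent.symm (h : NormallyEquivalent Q P) : NormallyEquivalent P Q :=
  fun c => (h c).symm

theorem NormallyEquivalent.exists_eq_singleton (h : NormallyEquivalent Q P) (hQ : IsPolytope Q)
    {c v : E} (hc : maxFace P c = {v}) : ∃ u, maxFace Q c = {u} := by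
  obtain ⟨u, hu⟩ := hQ.maxFace_nonempty c
  exact ⟨u, eq_singleton_of_vectorSpan_eq_bot hu
    ((h.vectorSpan_eq c).trans (vectorSpan_eq_bot_of_eq_singleton hc))⟩

/-- The functionals exposing `v` form a convex set, which allows a continuity argument along the
segment from `c` to `d`. -/
theorem maxFace_lineMap {c d v : E} (hc : maxFace P c = {v}) (hd : maxFace P d = {v}) {t : ℝ}
    (h0 : 0 ≤ t) (h1 : t ≤ 1) : maxFace P (c + t • (d - c)) = {v} := by
  have hvc : v ∈ maxFace P c := hc ▸ rfl
  have hvd : v ∈ maxFace P d := hd ▸ rfl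
  have key : ∀ p ∈ P, ⟪c + t • (d - c), v⟫ - ⟪c + t • (d - c), p⟫ =
      (1 - t) * (⟪c, v⟫ - ⟪c, p⟫) + t * (⟪d, v⟫ - ⟪d, p⟫) := fun p _ => by
    simp only [inner_add_left, real_inner_smul_left, inner_sub_left]; ring
  have hv : v ∈ maxFace P (c + t • (d - c)) := ⟨hvc.1, fun p hp => by
    have := key p hp
    have e1 := mul_nonneg (sub_nonneg.mpr h1) (sub_nonneg.mpr (hvc.2 p hp))
    have e2 := mul_nonneg h0 (sub_nonneg.mpr (hvd.2 p hp))
    linarith⟩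
  refine Set.eq_singleton_iff_unique_mem.mpr ⟨hv, fun p hp => ?_⟩
  by_contra hpv
  have e := key p hp.1
  rw [inner_eq_of_mem_maxFace hv hp, sub_self] at e
  have l1 := sub_pos.mpr (inner_lt_of_maxFace_eq hc hp.1 hpv)
  have l2 := sub_pos.mpr (inner_lt_of_maxFace_eq hd hp.1 hpv)
  rcases h0.eq_or_lt with rfl | h0
  · linarith
  · have e1 := mul_nonneg (sub_nonneg.mpr h1) l1.le
    have e2 := mul_pos h0 l2
    linarith

/-- If `c` and `d` expose the same vertex of `P`, then they expose the same vertex of a normally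
equivalent polytope. -/
theorem NormallyEquivalent.eq_of_maxFace_eq (h : NormallyEquivalent Q P) (hQ : IsPolytope Q)
    {c d v u : E} (hc : maxFace P c = {v}) (hd : maxFace P d = {v}) (hu : maxFace Q c = {u}) :
    maxFace Q d = {u} := by
  have huc : u ∈ maxFace Q c := hu ▸ rfl
  -- The parameters at which `u` is still optimal form a closed set. Every functional on the segment
  -- exposes a single vertex of `Q`, so optimality also persists for a short step to the right.
  set A : Set ℝ := {t | u ∈ maxFace Q (c + t • (d - c))} with hA
  have hclosed : IsClosed A := by
    have : A = ⋂ y ∈ Q, {t : ℝ | ⟪c + t • (d - c), y⟫ ≤ ⟪c + t • (d - c), u⟫} := by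
      ext t; simp [hA, maxFace, huc.1]
    rw [this]
    exact isClosed_biInter fun y _ => isClosed_le (by fun_prop) (by fun_prop)
  have hsub : Set.Icc (0 : ℝ) 1 ⊆ A := by
    apply (hclosed.inter isClosed_Icc).Icc_subset_of_forall_exists_gt
    · simpa [hA] using huc
    rintro t ⟨ht, h0, h1⟩ y hy
    obtain ⟨u', hu'⟩ := h.exists_eq_singleton hQ (maxFace_lineMap hc hd h0 h1.le)
    have hev := hQ.eventually_maxFace_add (c + t • (d - c)) (d - c)
    have hev2 : ∀ᶠ ε : ℝ in 𝓝[>] 0, ε < y - t :=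
      mem_nhdsWithin_of_mem_nhds (Iio_mem_nhds (sub_pos.mpr hy))
    obtain ⟨ε, ⟨e1, e2⟩, e3⟩ := ((hev.and hev2).and self_mem_nhdsWithin).exists
    refine ⟨t + ε, ?_, lt_add_of_pos_right t e3, by linarith⟩
    change u ∈ maxFace Q (c + (t + ε) • (d - c))
    rw [add_smul, ← add_assoc, e1]
    have hut : u ∈ maxFace Q (c + t • (d - c)) := ht
    rw [hu'] at hut ⊢
    rw [maxFace_singleton]
    exact hut
  have hud : u ∈ maxFace Q d := by
    simpa [hA] using hsub (Set.right_mem_Icc.mpr zero_le_one)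
  obtain ⟨u', hu'⟩ := h.exists_eq_singleton hQ hd
  rw [hu'] at hud ⊢
  rw [Set.mem_singleton_iff.mp hud]

open Classical in
/-- The vertex of `Q` that corresponds to the vertex `v` of a normally equivalent polytope `P`. -/
noncomputable def vertexMap (P Q : Set E) (v : E) : E :=
  if h : ∃ u c, maxFace P c = {v} ∧ maxFace Q c = {u} then h.choose else 0

theorem NormallyEquivalent.maxFace_eq_vertexMap (h : NormallyEquivalent Q P) (hQ : IsPolytope Q)
    {c v : E} (hc : maxFace P c = {v}) : maxFace Q c = {vertexMap P Q v} := by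
  have hex : ∃ u c, maxFace P c = {v} ∧ maxFace Q c = {u} := by
    obtain ⟨u, hu⟩ := h.exists_eq_singleton hQ hc
    exact ⟨u, c, hc, hu⟩
  rw [vertexMap, dif_pos hex]
  obtain ⟨d, hd, hd'⟩ := hex.choose_spec
  exact h.eq_of_maxFace_eq hQ hd hc hd'

theorem vectorSpan_convexHull_pair {v w x : E}
    (hx : x ∈ vectorSpan ℝ (convexHull ℝ ({v, w} : Set E))) : ∃ r : ℝ, x = r • (w - v) := by
  rw [← direction_affineSpan, affineSpan_convexHull, direction_affineSpan,
    vectorSpan_pair_rev ℝ, Submodule.mem_span_singleton] at hx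
  obtain ⟨r, hr⟩ := hx
  exact ⟨r, hr.symm⟩

theorem maxFace_pair {v w d : E} (h : ⟪d, v⟫ < ⟪d, w⟫) :
    maxFace (convexHull ℝ {v, w}) d = {w} := by
  have hG : IsPolytope (convexHull ℝ ({v, w} : Set E)) :=
    isPolytope_convexHull (Set.toFinite _) ⟨v, by simp⟩
  have hne := (hG.isPolytope_maxFace d).vertices_nonempty
  have hw : w ∈ maxFace (convexHull ℝ {v, w}) d :=
    hG.mem_maxFace (subset_convexHull ℝ _ (by simp)) fun p hp => by
      rcases extremePoints_convexHull_subset hp with rfl | rfl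
      · exact h.le
      · exact le_rfl
  have : maxFace (convexHull ℝ {v, w}) d ∩ vertices (convexHull ℝ {v, w}) ⊆ {w} := by
    rintro p ⟨hp1, hp2⟩
    rcases extremePoints_convexHull_subset hp2 with rfl | rfl
    · exact absurd (hp1.2 _ hw.1) (not_le.mpr h)
    · rfl
  rw [hG.maxFace_eq rfl, (Set.subset_singleton_iff_eq.mp this).resolve_left, convexHull_singleton]
  rw [← vertices_maxFace]
  exact hne.ne_empty

theorem supportFun_eq {c x : E} (hx : x ∈ maxFace P c) : supportFun P c = ⟪c, x⟫ := by
  apply IsGreatest.csSup_eq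
  refine ⟨⟨x, hx.1, rfl⟩, ?_⟩
  rintro _ ⟨y, hy, rfl⟩
  exact hx.2 y hy

variable [CompleteSpace E]

/-- Perturbing `c` slightly towards a functional that exposes `v` within the face singles out `v` in
`P`, and in `Q` a point still in the face of `c`. -/
theorem NormallyEquivalent.vertexMap_mem_maxFace (h : NormallyEquivalent Q P) (hP : IsPolytope P)
    (hQ : IsPolytope Q) {c v : E} (hv : v ∈ vertices P) (hc : v ∈ maxFace P c) :
    vertexMap P Q v ∈ maxFace Q c := by
  obtain ⟨d, hd⟩ := (hP.isPolytope_maxFace c).exists_maxFace_eq_singleton (v := v)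
    (by rw [vertices_maxFace]; exact ⟨hc, hv⟩)
  obtain ⟨ε, h1, h2⟩ := ((hP.eventually_maxFace_add c d).and
    (hQ.eventually_maxFace_add c d)).exists
  have h3 := h.maxFace_eq_vertexMap hQ (h1.trans hd)
  rw [h2] at h3
  exact (h3.symm.subset rfl : vertexMap P Q v ∈ maxFace (maxFace Q c) d).1

theorem NormallyEquivalent.vertices_eq (h : NormallyEquivalent Q P) (hP : IsPolytope P)
    (hQ : IsPolytope Q) : vertices Q = vertexMap P Q '' vertices P := by
  ext u
  constructor
  · intro hu
    obtain ⟨c, hc⟩ := hQ.exists_maxFace_eq_singleton hu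
    obtain ⟨v, hv⟩ := h.symm.exists_eq_singleton hP hc
    refine ⟨v, mem_vertices_of_maxFace_eq hv, ?_⟩
    have := h.maxFace_eq_vertexMap hQ hv
    rw [hc] at this
    exact (Set.singleton_eq_singleton_iff.mp this).symm
  · rintro ⟨v, hv, rfl⟩
    obtain ⟨c, hc⟩ := hP.exists_maxFace_eq_singleton hv
    exact mem_vertices_of_maxFace_eq (h.maxFace_eq_vertexMap hQ hc)

/-- Corresponding edges are parallel with the same orientation. -/
theorem NormallyEquivalent.exists_vertexMap_sub (h : NormallyEquivalent Q P) (hP : IsPolytope P)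
    (hQ : IsPolytope Q) {v w : E} (hvw : IsEdge P v w) :
    ∃ μ : ℝ, 0 < μ ∧ vertexMap P Q w - vertexMap P Q v = μ • (w - v) := by
  obtain ⟨hne, hv, hw, c, hc⟩ := hvw
  have hpos : 0 < ⟪w - v, w - v⟫ := real_inner_self_pos.mpr (sub_ne_zero.mpr hne.symm)
  have hvc : v ∈ maxFace P c := hc ▸ subset_convexHull ℝ _ (by simp)
  have hwc : w ∈ maxFace P c := hc ▸ subset_convexHull ℝ _ (by simp)
  have hspan := h.vectorSpan_eq c
  have h1 : vertexMap P Q w - vertexMap P Q v ∈ vectorSpan ℝ (maxFace Q c) :=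
    sub_mem_vectorSpan (h.vertexMap_mem_maxFace hP hQ hw hwc)
      (h.vertexMap_mem_maxFace hP hQ hv hvc)
  rw [hspan, hc] at h1
  obtain ⟨μ, hμ⟩ := vectorSpan_convexHull_pair h1
  refine ⟨μ, ?_, hμ⟩
  have e1 : maxFace (maxFace P c) (w - v) = {w} := by
    rw [hc]
    apply maxFace_pair
    rw [inner_sub_right] at hpos
    linarith
  have e2 : maxFace (maxFace P c) (-(w - v)) = {v} := by
    rw [hc, Set.pair_comm]
    apply maxFace_pair
    rw [inner_sub_right] at hpos
    simp only [inner_neg_left]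
    linarith
  have e3 : ∀ d u, maxFace (maxFace P c) d = {u} →
      maxFace (maxFace Q c) d = {vertexMap P Q u} := fun d u hu => by
    obtain ⟨ε, k1, k2⟩ := ((hP.eventually_maxFace_add c d).and
      (hQ.eventually_maxFace_add c d)).exists
    rw [← k2]
    exact h.maxFace_eq_vertexMap hQ (k1.trans hu)
  have f1 : vertexMap P Q w ∈ maxFace (maxFace Q c) (w - v) := (e3 _ _ e1).symm.subset rfl
  have f2 : vertexMap P Q v ∈ maxFace (maxFace Q c) (-(w - v)) := (e3 _ _ e2).symm.subset rfl
  have h2 : μ * ⟪w - v, w - v⟫ = ⟪w - v, vertexMap P Q w⟫ - ⟪w - v, vertexMap P Q v⟫ := by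
    rw [← inner_sub_right, hμ, real_inner_smul_right]
  have hbound : ∀ p ∈ maxFace Q c, ⟪w - v, vertexMap P Q v⟫ ≤ ⟪w - v, p⟫ ∧
      ⟪w - v, p⟫ ≤ ⟪w - v, vertexMap P Q w⟫ := fun p hp => by
    refine ⟨?_, f1.2 p hp⟩
    have := f2.2 p hp
    simp only [inner_neg_left] at this
    linarith
  -- The images of `v` and `w` are the minimum and maximum of `w - v` on the face of `Q`. For `μ ≤
  -- 0` this functional is constant there, hence orthogonal to the common linear span, which
  -- contains `w - v` itself.
  by_contra hμ0
  have h3 : ⟪w - v, w - v⟫ = 0 := by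
    apply inner_eq_zero_of_mem_vectorSpan (A := maxFace Q c)
    · intro p hp q hq
      have := mul_nonpos_of_nonpos_of_nonneg (not_lt.mp hμ0) hpos.le
      have b1 := hbound p hp
      have b2 := hbound q hq
      linarith [b1.1, b1.2, b2.1, b2.2]
    · rw [hspan]; exact sub_mem_vectorSpan hwc hvc
  exact hpos.ne' h3

end Correspondence

end InscribedCone

namespace InscribedCone

open Filter Topology

/-! ### The area form of a plane and odd polygons. -/

section Polygon

variable {E : Type*} [NormedAddCommGroup E] [InnerProductSpace ℝ E] {F : Set E}

/-- The bilinear form `a₁ ∧ a₂`. -/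
noncomputable def planeForm (a₁ a₂ x y : E) : ℝ :=
  ⟪a₁, x⟫ * ⟪a₂, y⟫ - ⟪a₂, x⟫ * ⟪a₁, y⟫

theorem eq_zero_of_mem_span_pair {a₁ a₂ x : E} (hx : x ∈ Submodule.span ℝ {a₁, a₂})
    (h1 : ⟪a₁, x⟫ = 0) (h2 : ⟪a₂, x⟫ = 0) : x = 0 := by
  obtain ⟨s, t, rfl⟩ := Submodule.mem_span_pair.mp hx
  rw [← inner_self_eq_zero (𝕜 := ℝ)]
  nth_rewrite 1 [inner_add_left]
  rw [real_inner_smul_left, real_inner_smul_left, h1, h2]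
  ring

/-- Pairing with `a₁` or `a₂` gives a `3 × 3` determinant with a repeated row. -/
theorem planeForm_cyclic {a₁ a₂ x y u : E} (hx : x ∈ Submodule.span ℝ {a₁, a₂})
    (hy : y ∈ Submodule.span ℝ {a₁, a₂}) (hu : u ∈ Submodule.span ℝ {a₁, a₂}) :
    planeForm a₁ a₂ x y • u + planeForm a₁ a₂ y u • x + planeForm a₁ a₂ u x • y = 0 := by
  refine eq_zero_of_mem_span_pair (a₁ := a₁) (a₂ := a₂)
    (add_mem (add_mem (Submodule.smul_mem _ _ hu) (Submodule.smul_mem _ _ hx))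
      (Submodule.smul_mem _ _ hy)) ?_ ?_ <;>
  · simp only [inner_add_right, real_inner_smul_right, planeForm]
    ring

theorem exists_eq_smul_of_planeForm_eq_zero {a₁ a₂ x y : E}
    (hx : x ∈ Submodule.span ℝ {a₁, a₂}) (hy : y ∈ Submodule.span ℝ {a₁, a₂}) (hx0 : x ≠ 0)
    (h : planeForm a₁ a₂ x y = 0) : ∃ r : ℝ, y = r • x := by
  simp only [planeForm] at h
  have key : ∀ i ∈ ({a₁, a₂} : Set E), ⟪i, x⟫ • y - ⟪i, y⟫ • x = 0 := by
    intro i hi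
    refine eq_zero_of_mem_span_pair (a₁ := a₁) (a₂ := a₂)
      (sub_mem (Submodule.smul_mem _ _ hy) (Submodule.smul_mem _ _ hx)) ?_ ?_ <;>
    · simp only [inner_sub_right, real_inner_smul_right]
      rcases hi with rfl | rfl <;> linarith
  have : ∃ i ∈ ({a₁, a₂} : Set E), ⟪i, x⟫ ≠ 0 := by
    by_contra! hc
    exact hx0 (eq_zero_of_mem_span_pair hx (hc a₁ (by simp)) (hc a₂ (by simp)))
  obtain ⟨i, hi, hne⟩ := this
  refine ⟨⟪i, x⟫⁻¹ * ⟪i, y⟫, ?_⟩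
  rw [mul_smul, ← sub_eq_zero.mp (key i hi), inv_smul_smul₀ hne]

/-- The form `a₁ ∧ a₂` changes its sign under a reflection of the plane spanned by `a₁, a₂`. -/
theorem planeForm_reflect {a₁ a₂ e x y x' y' : E} {α β : ℝ}
    (he : e ∈ Submodule.span ℝ {a₁, a₂}) (he0 : e ≠ 0)
    (hx : x' - x = α • e) (hx' : ⟪e, x' + x⟫ = 0) (hy : y' - y = β • e)
    (hy' : ⟪e, y' + y⟫ = 0) : planeForm a₁ a₂ x' y' = -planeForm a₁ a₂ x y := by
  obtain rfl : x' = x + α • e := by rw [← hx]; abel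
  obtain rfl : y' = y + β • e := by rw [← hy]; abel
  have hN : ⟪e, e⟫ ≠ 0 := inner_self_ne_zero.mpr he0
  obtain ⟨s, t, hst⟩ := Submodule.mem_span_pair.mp he
  have hz : ∀ z : E, ⟪e, z⟫ = s * ⟪a₁, z⟫ + t * ⟪a₂, z⟫ := fun z => by
    rw [← hst, inner_add_left, real_inner_smul_left, real_inner_smul_left]
  -- Multiplying by `⟪e, e⟫` clears the denominator of the reflection.
  apply mul_left_cancel₀ hN
  simp only [planeForm, inner_add_right, real_inner_smul_right] at hx' hy' ⊢
  rw [hz e] at hx' hy' ⊢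
  rw [hz x] at hx'
  rw [hz y] at hy'
  linear_combination (⟪a₁, x⟫ * ⟪a₂, e⟫ - ⟪a₂, x⟫ * ⟪a₁, e⟫) * hy' +
    (⟪a₁, e⟫ * ⟪a₂, y⟫ - ⟪a₂, e⟫ * ⟪a₁, y⟫) * hx'

theorem planeForm_swap (a₁ a₂ x y : E) : planeForm a₁ a₂ y x = -planeForm a₁ a₂ x y := by
  simp only [planeForm]; ring

variable [CompleteSpace E]

/-- Every vertex of a polygon has a next vertex in the positive orientation. -/
theorem IsPolytope.exists_next_vertex (hF : IsPolytope F) {a₁ a₂ : E}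
    (hspan : vectorSpan ℝ F ≤ Submodule.span ℝ {a₁, a₂}) {v p₀ : E} (hv : v ∈ vertices F)
    (hp₀ : p₀ ∈ vertices F) (hpv : p₀ ≠ v) :
    ∃ w, IsEdge F v w ∧ ∀ p ∈ vertices F, 0 ≤ planeForm a₁ a₂ (w - v) (p - v) := by
  obtain ⟨b, hb⟩ := hF.exists_maxFace_eq_singleton hv
  have hs : ∀ p ∈ vertices F, p - v ∈ Submodule.span ℝ {a₁, a₂} := fun p hp =>
    hspan (sub_mem_vectorSpan hp.1 hv.1)
  -- The quotient is the form evaluated at `p₀ - v` and the figure point of `p`; its minimum selects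
  -- the extreme clockwise direction at `v`.
  obtain ⟨w, ⟨hw, hwv⟩, hmin⟩ := Set.exists_min_image (vertices F \ {v})
    (fun p => planeForm a₁ a₂ (p₀ - v) (p - v) / ⟪b, v - p⟫) hF.finite_vertices.sdiff
    ⟨p₀, hp₀, hpv⟩
  replace hwv : w ≠ v := hwv
  have hB : ∀ p ∈ vertices F, p ≠ v → 0 < ⟪b, v - p⟫ := fun p hp hpv =>
    inner_sub_pos_of_maxFace_eq hb hp hpv
  have hpos : ∀ p ∈ vertices F, 0 ≤ planeForm a₁ a₂ (w - v) (p - v) := by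
    intro p hp
    by_cases e : p = v
    · simp [e, planeForm]
    have h1 := hmin p ⟨hp, e⟩
    rw [div_le_div_iff₀ (hB w hw hwv) (hB p hp e)] at h1
    -- Paired with `b`, the cyclic identity turns the comparison of quotients into the sign of the
    -- form at `w - v`, `p - v`.
    have h2 := congrArg (fun x => ⟪b, x⟫) (planeForm_cyclic (hs w hw) (hs p hp) (hs p₀ hp₀))
    simp only [inner_add_right, real_inner_smul_right, inner_zero_right] at h2
    rw [planeForm_swap a₁ a₂ (p₀ - v) (p - v)] at h2
    have hneg : ∀ q : E, ⟪b, q - v⟫ = -⟪b, v - q⟫ := fun q => by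
      rw [← inner_neg_right, neg_sub]
    rw [hneg, hneg, hneg] at h2
    refine nonneg_of_mul_nonneg_left ?_ (hB p₀ hp₀ hpv)
    nlinarith
  -- This vector represents `-planeForm a₁ a₂ (w - v)`, which is zero on the edge direction and
  -- nonpositive towards every vertex.
  refine ⟨w, ⟨hwv.symm, hv, hw, -(⟪a₁, w - v⟫ • a₂ - ⟪a₂, w - v⟫ • a₁), ?_⟩, hpos⟩
  set c := -(⟪a₁, w - v⟫ • a₂ - ⟪a₂, w - v⟫ • a₁)
  have hc : ∀ p, ⟪c, p⟫ - ⟪c, v⟫ = -planeForm a₁ a₂ (w - v) (p - v) := fun p => by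
    simp only [c, planeForm, inner_neg_left, inner_sub_left, real_inner_smul_left,
      inner_sub_right]
    ring
  have hvc : v ∈ maxFace F c := hF.mem_maxFace hv.1 fun p hp => by
    have := hc p
    have := hpos p hp
    linarith
  apply hF.maxFace_eq
  ext p
  simp only [Set.mem_inter_iff, Set.mem_insert_iff, Set.mem_singleton_iff]
  constructor
  · rintro ⟨h1, h2⟩
    have h3 := hc p
    rw [inner_eq_of_mem_maxFace h1 hvc, sub_self, eq_comm, neg_eq_zero] at h3
    obtain ⟨r, hr⟩ := exists_eq_smul_of_planeForm_eq_zero (hs w hw) (hs p h2)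
      (sub_ne_zero.mpr hwv) h3
    have h4 : p = v + r • (w - v) := by rw [← hr]; abel
    rw [h4] at h2
    rcases eq_zero_or_one_of_vertices hv hw h2 hwv.symm with rfl | rfl
    · left; rw [h4]; simp
    · right; rw [h4]; simp
  · rintro (rfl | rfl)
    · exact ⟨hvc, hv⟩
    · refine ⟨mem_maxFace_of_inner_eq hvc hw.1 ?_, hw⟩
      have h5 := hc p
      simp only [planeForm] at h5
      linarith

/-- A function on the vertices of an odd polygon that changes its sign along every edge
vanishes. -/
theorem IsPolytope.eq_zero_of_odd (hF : IsPolytope F) {a₁ a₂ : E}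
    (hspan : vectorSpan ℝ F ≤ Submodule.span ℝ {a₁, a₂}) (hne : vectorSpan ℝ F ≠ ⊥)
    (hodd : Odd (vertices F).ncard) {D : E → ℝ} (hD : ∀ v w, IsEdge F v w → D w = -D v)
    {v₀ : E} (hv₀ : v₀ ∈ vertices F) : D v₀ = 0 := by
  by_contra h0
  have habs : ∀ v ∈ vertices F, |D v| = |D v₀| := fun v hv =>
    hF.induction_on_edges (S := fun v => |D v| = |D v₀|) hv₀ rfl
      (fun v w hvw h => by rw [hD v w hvw, abs_neg, h]) hv
  have hne0 : ∀ v ∈ vertices F, D v ≠ 0 := fun v hv h => h0 <| by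
    have := habs v hv
    rw [h, abs_zero, eq_comm, abs_eq_zero] at this
    exact this
  have hother : ∀ v ∈ vertices F, ∃ p ∈ vertices F, p ≠ v := fun v hv => by
    by_contra! h
    refine hne (vectorSpan_eq_bot_of_eq_singleton (v := v) ?_)
    rw [← hF.convexHull_vertices, Set.eq_singleton_iff_unique_mem.mpr ⟨hv, h⟩,
      convexHull_singleton]
  have hnext : ∀ v ∈ vertices F, ∃ w, IsEdge F v w ∧
      ∀ p ∈ vertices F, 0 ≤ planeForm a₁ a₂ (w - v) (p - v) := fun v hv => by
    obtain ⟨p, hp, hpv⟩ := hother v hv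
    exact hF.exists_next_vertex hspan hv hp hpv
  choose! σ hσ hσ' using hnext
  -- If `σ v = σ v'`, both signs hold for the form at `σ v - v`, `v' - v`, so `v'` is a vertex on
  -- the line through `v` and `σ v`.
  have hinj : Set.InjOn σ (vertices F) := by
    intro v hv v' hv' h
    have h1 := hσ' v hv v' hv'
    have h2 := hσ' v' hv' v hv
    rw [← h] at h2
    have h3 : planeForm a₁ a₂ (σ v - v) (v' - v) = 0 := by
      have : planeForm a₁ a₂ (σ v - v') (v - v') = -planeForm a₁ a₂ (σ v - v) (v' - v) := by
        simp only [planeForm, inner_sub_right]; ring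
      linarith
    obtain ⟨hvw, -, hw, -⟩ := hσ v hv
    obtain ⟨hvw', -⟩ := hσ v' hv'
    rw [← h] at hvw'
    obtain ⟨r, hr⟩ := exists_eq_smul_of_planeForm_eq_zero (hspan (sub_mem_vectorSpan hw.1 hv.1))
      (hspan (sub_mem_vectorSpan hv'.1 hv.1)) (sub_ne_zero.mpr hvw.symm) h3
    have h4 : v' = v + r • (σ v - v) := by rw [← hr]; abel
    have h5 := hv'
    rw [h4] at h5
    rcases eq_zero_or_one_of_vertices hv hw h5 hvw with rfl | rfl
    · rw [h4]; simp
    · exact absurd (by rw [h4]; simp) hvw'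
  have hfin := hF.finite_vertices
  -- The injection `σ` exchanges vertices of positive and negative `D`, so there are equally many of
  -- each and the total is even.
  set A := {v | v ∈ vertices F ∧ 0 < D v} with hA
  set B := {v | v ∈ vertices F ∧ D v < 0} with hB
  have hAf : A.Finite := hfin.subset fun _ h => h.1
  have hBf : B.Finite := hfin.subset fun _ h => h.1
  have h1 : A.ncard ≤ B.ncard := Set.ncard_le_ncard_of_injOn σ
    (fun v hv => ⟨(hσ v hv.1).2.2.1, by rw [hD _ _ (hσ v hv.1)]; exact neg_lt_zero.mpr hv.2⟩)
    (hinj.mono fun _ h => h.1) hBf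
  have h2 : B.ncard ≤ A.ncard := Set.ncard_le_ncard_of_injOn σ
    (fun v hv => ⟨(hσ v hv.1).2.2.1, by rw [hD _ _ (hσ v hv.1)]; exact neg_pos.mpr hv.2⟩)
    (hinj.mono fun _ h => h.1) hAf
  have h3 : vertices F = A ∪ B := by
    ext v
    constructor
    · intro hv
      rcases (hne0 v hv).lt_or_gt with h | h
      · exact Or.inr ⟨hv, h⟩
      · exact Or.inl ⟨hv, h⟩
    · rintro (h | h) <;> exact h.1
  have h4 : Disjoint A B := Set.disjoint_left.mpr fun v h h' => lt_asymm h.2 h'.2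
  rw [h3, Set.ncard_union_eq h4 hAf hBf, le_antisymm h1 h2] at hodd
  exact (Nat.not_odd_iff_even.mpr (Even.add_self _)) hodd

end Polygon

end InscribedCone

namespace InscribedCone

/-! ### Inscribed polytopes as families of reflected vectors. -/

section ReflectionSpace

variable {E : Type*} [NormedAddCommGroup E] [InnerProductSpace ℝ E] {P Q : Set E}

/-- The families of vectors indexed by the vertices of `P` such that neighbours are related by
the reflection along the edge. -/
def reflectionSpace (P : Set E) : Submodule ℝ (E → E) where
  -- The first two conditions remove irrelevant freedom: values off the vertices, and components
  -- orthogonal to `P`.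
  carrier := {y | (∀ v, v ∉ vertices P → y v = 0) ∧
    (∀ v ∈ vertices P, y v ∈ vectorSpan ℝ P) ∧
    ∀ v w, IsEdge P v w → (∃ α : ℝ, y w - y v = α • (w - v)) ∧ ⟪w - v, y w + y v⟫ = 0}
  zero_mem' := by
    refine ⟨fun _ _ => rfl, fun _ _ => zero_mem _, fun v w _ => ⟨⟨0, by simp⟩, by simp⟩⟩
  add_mem' := by
    rintro x y ⟨hx1, hx2, hx3⟩ ⟨hy1, hy2, hy3⟩
    refine ⟨fun v hv => by simp [hx1 v hv, hy1 v hv],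
      fun v hv => add_mem (hx2 v hv) (hy2 v hv), fun v w h => ?_⟩
    obtain ⟨⟨α, hα⟩, ha⟩ := hx3 v w h
    obtain ⟨⟨β, hβ⟩, hb⟩ := hy3 v w h
    refine ⟨⟨α + β, ?_⟩, ?_⟩
    · rw [add_smul, ← hα, ← hβ]; simp only [Pi.add_apply]; abel
    · simp only [Pi.add_apply, inner_add_right] at *; linarith
  smul_mem' := by
    rintro a x ⟨hx1, hx2, hx3⟩
    refine ⟨fun v hv => by simp [hx1 v hv], fun v hv => Submodule.smul_mem _ _ (hx2 v hv),
      fun v w h => ?_⟩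
    obtain ⟨⟨α, hα⟩, ha⟩ := hx3 v w h
    refine ⟨⟨a * α, ?_⟩, ?_⟩
    · rw [mul_smul, ← hα, Pi.smul_apply, Pi.smul_apply, smul_sub]
    · rw [Pi.smul_apply, Pi.smul_apply, ← smul_add, inner_smul_right, ha, mul_zero]

/-- If `y v = 0`, then `y w` is both a multiple of the edge `w - v` and orthogonal to it. Hence
evaluation at one vertex is injective, which is what bounds dimensions. -/
theorem IsPolytope.eq_zero_of_mem_reflectionSpace [CompleteSpace E] (hP : IsPolytope P)
    {y : E → E} (hy : y ∈ reflectionSpace P) {v₀ : E} (hv₀ : v₀ ∈ vertices P)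
    (h₀ : y v₀ = 0) : y = 0 := by
  ext v
  by_cases hv : v ∈ vertices P
  · refine hP.induction_on_edges (S := fun v => y v = 0) hv₀ h₀ (fun v w hvw h => ?_) hv
    obtain ⟨⟨α, hα⟩, ha⟩ := hy.2.2 v w hvw
    rw [h, sub_zero] at hα
    rw [h, hα, add_zero, real_inner_smul_right, mul_eq_zero] at ha
    rw [hα, ha.resolve_right (inner_self_ne_zero.mpr (sub_ne_zero.mpr hvw.1.symm)), zero_smul]
  · exact hy.1 v hv

variable [FiniteDimensional ℝ E]

theorem NormallyEquivalent.exists_mem_reflectionSpace (h : NormallyEquivalent Q P)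
    (hP : IsPolytope P) (hQ : IsPolytope Q) (hI : IsInscribed Q) :
    ∃ y ∈ reflectionSpace P, ∃ z, ∀ v ∈ vertices P, vertexMap P Q v = z + y v := by
  classical
  obtain ⟨z₀, r, hr⟩ := hI
  obtain ⟨v₀, hv₀⟩ := hP.vertices_nonempty
  set M := vectorSpan ℝ P
  have hVQ : ∀ v ∈ vertices P, vertexMap P Q v ∈ vertices Q := fun v hv => by
    rw [h.vertices_eq hP hQ]; exact ⟨v, hv, rfl⟩
  have hM : vectorSpan ℝ Q = M := by simpa [maxFace_zero] using h.vectorSpan_eq 0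
  set x := vertexMap P Q v₀ - z₀ with hx
  -- The projection of the centre `z₀` to the affine hull of `Q`; it differs from `z₀` by a vector
  -- orthogonal to all edges.
  set z := vertexMap P Q v₀ - M.starProjection x with hz
  have hperp : z₀ - z ∈ Mᗮ := by
    have : z₀ - z = -(x - M.starProjection x) := by rw [hz, hx]; abel
    rw [this]
    exact neg_mem (M.sub_starProjection_mem_orthogonal x)
  have hdist : ∀ v ∈ vertices P, ⟪vertexMap P Q v - z₀, vertexMap P Q v - z₀⟫ = r ^ 2 :=
    fun v hv => by
      have := hr (hVQ v hv)
      rw [mem_sphere_iff_norm] at this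
      rw [real_inner_self_eq_norm_sq, this]
  refine ⟨fun v => if v ∈ vertices P then vertexMap P Q v - z else 0, ⟨?_, ?_, ?_⟩, z, ?_⟩
  · intro v hv
    simp [hv]
  · intro v hv
    have e : vertexMap P Q v - z = (vertexMap P Q v - vertexMap P Q v₀) + M.starProjection x := by
      rw [hz]; abel
    simp only [hv, if_true, e]
    refine add_mem ?_ (M.starProjection_apply_mem x)
    change _ ∈ M
    rw [← hM]
    exact sub_mem_vectorSpan (hVQ v hv).1 (hVQ v₀ hv₀).1
  · intro v w hvw
    obtain ⟨-, hv, hw, -⟩ := id hvw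
    obtain ⟨μ, hμ, e⟩ := h.exists_vertexMap_sub hP hQ hvw
    simp only [hv, hw, if_true, sub_sub_sub_cancel_right]
    refine ⟨⟨μ, e⟩, ?_⟩
    have h1 : ⟪w - v, z₀ - z⟫ = 0 := hperp _ (sub_mem_vectorSpan hw.1 hv.1)
    -- Vectors `p`, `q` of equal length satisfy `⟪p - q, p + q⟫ = 0`, and here `p - q` is `μ` times
    -- the edge.
    have h2 : μ * ⟪w - v, (vertexMap P Q w - z₀) + (vertexMap P Q v - z₀)⟫ = 0 := by
      rw [← real_inner_smul_left, ← e]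
      have e1 := hdist w hw
      have e2 := hdist v hv
      rw [← sub_sub_sub_cancel_right _ _ z₀]
      generalize vertexMap P Q w - z₀ = p at *
      generalize vertexMap P Q v - z₀ = q at *
      rw [inner_add_right, inner_sub_left, inner_sub_left, real_inner_comm p q]
      linarith
    have h3 : vertexMap P Q w - z + (vertexMap P Q v - z) =
        ((vertexMap P Q w - z₀) + (vertexMap P Q v - z₀)) + ((z₀ - z) + (z₀ - z)) := by abel
    rw [h3, inner_add_right, inner_add_right _ (z₀ - z), h1,
      (mul_eq_zero.mp h2).resolve_left hμ.ne']
    simp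
  · intro v hv
    simp [hv]

open Classical in
/-- A vertex of `P` that maximizes `⟪c, ·⟫`. -/
noncomputable def topVertex (P : Set E) (c : E) : E :=
  if h : (vertices (maxFace P c)).Nonempty then h.choose else 0

omit [FiniteDimensional ℝ E] in
theorem IsPolytope.topVertex_mem (hP : IsPolytope P) (c : E) :
    topVertex P c ∈ maxFace P c ∩ vertices P := by
  have h := (hP.isPolytope_maxFace c).vertices_nonempty
  rw [topVertex, dif_pos h, ← vertices_maxFace]
  exact h.choose_spec

/-- The class of the support function of the polytope with the given vertices. -/
noncomputable def familyClass (P : Set E) : (E → E) →ₗ[ℝ] (E → ℝ) ⧸ linearFuns E :=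
  (linearFuns E).mkQ ∘ₗ
    { toFun := fun y c => ⟪c, y (topVertex P c)⟫
      map_add' := fun x y => by ext c; simp [inner_add_right]
      map_smul' := fun a y => by ext c; simp [inner_smul_right] }

theorem NormallyEquivalent.supportFun_eq (h : NormallyEquivalent Q P) (hP : IsPolytope P)
    (hQ : IsPolytope Q) (c : E) : supportFun Q c = ⟪c, vertexMap P Q (topVertex P c)⟫ :=
  InscribedCone.supportFun_eq
    (h.vertexMap_mem_maxFace hP hQ (hP.topVertex_mem c).2 (hP.topVertex_mem c).1)

/-- The centre `z` contributes only the linear function `⟪·, z⟫` to the support function and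
disappears in the quotient. -/
theorem IsPolytope.inCone_subset (hP : IsPolytope P) :
    inCone P ⊆ (reflectionSpace P).map (familyClass P) := by
  rintro _ ⟨Q, hQ, hI, h, rfl⟩
  obtain ⟨y, hy, z, hz⟩ := h.exists_mem_reflectionSpace hP hQ hI
  refine ⟨y, hy, ?_⟩
  rw [familyClass, translationClass, LinearMap.comp_apply, Submodule.mkQ_apply,
    Submodule.mkQ_apply, Submodule.Quotient.eq]
  refine ⟨-z, ?_⟩
  ext c
  simp [h.supportFun_eq hP hQ, hz _ (hP.topVertex_mem c).2, inner_add_right]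

omit [FiniteDimensional ℝ E] in
/-- The condition that an odd `2`-face imposes on the reflection space. -/
theorem IsPolytope.planeForm_eq_zero_of_odd [CompleteSpace E] (hP : IsPolytope P) {F : Set E}
    (hF : IsOddTwoFace P F) {a₁ a₂ : E} (hspan : vectorSpan ℝ F ≤ Submodule.span ℝ {a₁, a₂})
    {x y : E → E} (hx : x ∈ reflectionSpace P) (hy : y ∈ reflectionSpace P) {v : E}
    (hv : v ∈ vertices F) : planeForm a₁ a₂ (x v) (y v) = 0 := by
  obtain ⟨⟨⟨c, rfl⟩, hdim⟩, hodd⟩ := hF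
  refine (hP.isPolytope_maxFace c).eq_zero_of_odd (D := fun v => planeForm a₁ a₂ (x v) (y v))
    hspan ?_ hodd (fun v w hvw => ?_) hv
  · intro h
    rw [polyDim_eq, h, finrank_bot] at hdim
    norm_num at hdim
  · have hvw' := hP.isEdge_of_maxFace c hvw
    obtain ⟨⟨α, hα⟩, ha⟩ := hx.2.2 v w hvw'
    obtain ⟨⟨β, hβ⟩, hb⟩ := hy.2.2 v w hvw'
    exact planeForm_reflect (hspan (sub_mem_vectorSpan hvw.2.2.1.1 hvw.2.1.1))
      (sub_ne_zero.mpr hvw.1.symm) hα ha hβ hb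

end ReflectionSpace

end InscribedCone

namespace InscribedCone

open Filter Topology

/-! ### Equal normal fans imply normal equivalence. -/

section NormalFan

variable {E : Type*} [NormedAddCommGroup E] [InnerProductSpace ℝ E] {P Q : Set E}

/-- The normal cone at the face of `c` is the smallest cone of the fan containing `c`, so the fan
alone determines it. -/
theorem normalCone_subset_of_normalFan_eq (h : normalFan Q = normalFan P) (c : E) :
    normalCone Q (maxFace Q c) ⊆ normalCone P (maxFace P c) := by
  have : normalCone P (maxFace P c) ∈ normalFan Q := h ▸ ⟨_, ⟨c, rfl⟩, rfl⟩
  obtain ⟨G, -, hG⟩ := this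
  rw [hG]
  have hc : c ∈ normalCone Q G := hG ▸ (fun _ h => h : c ∈ normalCone P (maxFace P c))
  exact fun d hd => Set.Subset.trans hc hd

variable [FiniteDimensional ℝ E]

/-- A small step from `c` in any direction orthogonal to the face stays in the normal cone. The cone
therefore spans the orthogonal complement of the face, and determines its direction. -/
theorem IsPolytope.mem_vectorSpan_maxFace_iff (hP : IsPolytope P) (c x : E) :
    x ∈ vectorSpan ℝ (maxFace P c) ↔ ∀ d ∈ normalCone P (maxFace P c), ⟪d, x⟫ = 0 := by
  refine ⟨fun hx d hd => inner_eq_zero_of_mem_vectorSpan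
    (fun p hp q hq => inner_eq_of_mem_maxFace (hd hp) (hd hq)) hx, fun h => ?_⟩
  rw [← Submodule.orthogonal_orthogonal (vectorSpan ℝ (maxFace P c))]
  intro d hd
  obtain ⟨ε, h1, h2⟩ := ((hP.eventually_maxFace_add c d).and self_mem_nhdsWithin).exists
  have h3 : maxFace P c ⊆ maxFace (maxFace P c) d := fun p hp => by
    refine ⟨hp, fun q hq => ?_⟩
    have := hd _ (sub_mem_vectorSpan hp hq)
    rw [real_inner_comm, inner_sub_right, sub_eq_zero] at this
    exact this.ge
  have h4 := h (c + ε • d) (by rw [normalCone, Set.mem_ofPred_eq, h1]; exact h3)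
  have h5 := h c (fun _ h => h)
  rw [inner_add_left, h5, zero_add, real_inner_smul_left] at h4
  exact (mul_eq_zero.mp h4).resolve_left (ne_of_gt h2)

theorem IsPolytope.normallyEquivalent_of_normalFan_eq (hP : IsPolytope P) (hQ : IsPolytope Q)
    (h : normalFan Q = normalFan P) : NormallyEquivalent Q P := by
  intro c
  rw [AffineSubspace.parallel_iff_direction_eq_and_eq_bot_iff_eq_bot, direction_affineSpan,
    direction_affineSpan]
  constructor
  · ext x
    rw [hP.mem_vectorSpan_maxFace_iff, hQ.mem_vectorSpan_maxFace_iff,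
      (normalCone_subset_of_normalFan_eq h c).antisymm
        (normalCone_subset_of_normalFan_eq h.symm c)]
  · simp [affineSpan_eq_bot, (hP.maxFace_nonempty c).ne_empty, (hQ.maxFace_nonempty c).ne_empty]

end NormalFan

/-! ### Linear algebra in dimensions two and three. -/

section LinearAlgebra

variable {E : Type*} [NormedAddCommGroup E] [InnerProductSpace ℝ E] [FiniteDimensional ℝ E]

theorem span_pair_eq_of_finrank_eq_two {L : Submodule ℝ E} (hL : Module.finrank ℝ L = 2)
    {e f : E} (he : e ∈ L) (hf : f ∈ L) (he0 : e ≠ 0) (hfe : f ∉ Submodule.span ℝ {e}) :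
    L = Submodule.span ℝ {e, f} := by
  symm
  apply Submodule.eq_of_le_of_finrank_le
  · rw [Submodule.span_le]
    rintro x (rfl | rfl) <;> assumption
  · have h1 := finrank_span_singleton (K := ℝ) he0
    have h2 : Submodule.span ℝ {e} < Submodule.span ℝ {e, f} :=
      lt_of_le_of_ne (Submodule.span_mono (by simp)) fun h =>
        hfe (h ▸ Submodule.subset_span (by simp))
    have := Submodule.finrank_lt_finrank_of_lt h2
    omega

theorem exists_notMem_of_lt_finrank {L K : Submodule ℝ E}
    (h : Module.finrank ℝ K < Module.finrank ℝ L) : ∃ f ∈ L, f ∉ K := by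
  by_contra! hc
  exact (Submodule.finrank_mono (show L ≤ K from hc)).not_gt h

theorem eq_zero_of_finrank_eq_three {M : Submodule ℝ E} (hM : Module.finrank ℝ M = 3)
    {e f g x : E} (he : e ∈ M) (hf : f ∈ M) (hg : g ∈ M) (he0 : e ≠ 0)
    (hfe : f ∉ Submodule.span ℝ {e}) (hge : g ∉ Submodule.span ℝ {e, f}) (hx : x ∈ M)
    (h1 : ⟪e, x⟫ = 0) (h2 : ⟪f, x⟫ = 0) (h3 : ⟪g, x⟫ = 0) : x = 0 := by
  have hK : Submodule.span ℝ {e, f, g} = M := by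
    apply Submodule.eq_of_le_of_finrank_le
    · rw [Submodule.span_le]
      rintro x (rfl | rfl | rfl) <;> assumption
    · have h1 := finrank_span_singleton (K := ℝ) he0
      have h2 : Submodule.span ℝ {e} < Submodule.span ℝ {e, f} :=
        lt_of_le_of_ne (Submodule.span_mono (by simp)) fun h =>
          hfe (h ▸ Submodule.subset_span (by simp))
      have h3 : Submodule.span ℝ {e, f} < Submodule.span ℝ {e, f, g} :=
        lt_of_le_of_ne (Submodule.span_mono (by intro; simp; tauto)) fun h =>
          hge (h ▸ Submodule.subset_span (by simp))
      have := Submodule.finrank_lt_finrank_of_lt h2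
      have := Submodule.finrank_lt_finrank_of_lt h3
      omega
  rw [← hK] at hx
  rw [← inner_self_eq_zero (𝕜 := ℝ)]
  have : Submodule.span ℝ {e, f, g} ≤ (Submodule.span ℝ {x})ᗮ := by
    rw [Submodule.span_le]
    rintro y hy
    rw [SetLike.mem_coe, Submodule.mem_orthogonal_singleton_iff_inner_left]
    rcases hy with rfl | rfl | rfl <;> assumption
  exact Submodule.mem_orthogonal_singleton_iff_inner_left.mp (this hx)

end LinearAlgebra

/-! ### Constraints from odd 2-faces, and homothety. -/

section OddFaces

variable {E : Type*} [NormedAddCommGroup E] [InnerProductSpace ℝ E] [FiniteDimensional ℝ E]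
  {P Q : Set E}

theorem IsOddTwoFace.inner_eq_zero (hP : IsPolytope P) {F : Set E} (hF : IsOddTwoFace P F)
    {e f v : E} (hspan : vectorSpan ℝ F = Submodule.span ℝ {e, f}) (hv : v ∈ vertices F)
    {x y : E → E} (hx : x ∈ reflectionSpace P) (hy : y ∈ reflectionSpace P)
    (hxe : ⟪e, x v⟫ ≠ 0) (hye : ⟪e, y v⟫ = 0) : ⟪f, y v⟫ = 0 := by
  have h := hP.planeForm_eq_zero_of_odd hF hspan.le hx hy hv
  rw [planeForm, hye, mul_zero, sub_zero] at h
  exact (mul_eq_zero.mp h).resolve_left hxe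

theorem IsPolytope.exists_isEdge_of_polyDim_pos (hP : IsPolytope P) (h : 0 < polyDim P) :
    ∃ v w, IsEdge P v w := by
  obtain ⟨v, hv⟩ := hP.vertices_nonempty
  have : ∃ p ∈ P, p ≠ v := by
    by_contra! hc
    rw [polyDim_eq, vectorSpan_eq_bot_of_eq_singleton
      (Set.eq_singleton_iff_unique_mem.mpr ⟨hv.1, hc⟩), finrank_bot] at h
    exact h.false
  obtain ⟨p, hp, hpv⟩ := this
  exact ⟨v, hP.exists_isEdge hv hp hpv⟩

/-- By reflection, a zero component of `y v` along the edge would make `y w = y v`, collapsing an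
edge of `Q`. -/
theorem NormallyEquivalent.inner_ne_zero (h : NormallyEquivalent Q P) (hP : IsPolytope P)
    (hQ : IsPolytope Q) {y : E → E} (hy : y ∈ reflectionSpace P) {z : E}
    (hz : ∀ v ∈ vertices P, vertexMap P Q v = z + y v) {v w : E} (hvw : IsEdge P v w) :
    ⟪w - v, y v⟫ ≠ 0 := by
  intro h0
  obtain ⟨μ, hμ, e⟩ := h.exists_vertexMap_sub hP hQ hvw
  rw [hz w hvw.2.2.1, hz v hvw.2.1, add_sub_add_left_eq_sub] at e
  have h1 := (hy.2.2 v w hvw).2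
  rw [sub_eq_iff_eq_add.mp e, inner_add_right, inner_add_right, h0, add_zero, add_zero,
    real_inner_smul_right, mul_eq_zero, inner_self_eq_zero, sub_eq_zero] at h1
  exact h1.elim hμ.ne' fun h => hvw.1 h.symm

/-- An odd `2`-face of a `3`-polytope cuts the reflection space down to dimension two. -/
theorem IsOddTwoFace.exists_forall_eq_zero (hP : IsPolytope P) (hdim : polyDim P = 3)
    {F : Set E} (hF : IsOddTwoFace P F) : ∃ v w g, IsEdge P v w ∧
      ∀ x ∈ reflectionSpace P, ∀ y ∈ reflectionSpace P, ⟪w - v, x v⟫ ≠ 0 →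
        ⟪w - v, y v⟫ = 0 → ⟪g, y v⟫ = 0 → y = 0 := by
  obtain ⟨⟨⟨c, hc⟩, hF2⟩, -⟩ := id hF
  have hFp : IsPolytope F := hc ▸ hP.isPolytope_maxFace c
  obtain ⟨v, w, hvw⟩ := hFp.exists_isEdge_of_polyDim_pos (by omega)
  have hvwP : IsEdge P v w := hP.isEdge_of_maxFace c (hc ▸ hvw)
  have hFP : vectorSpan ℝ F ≤ vectorSpan ℝ P := vectorSpan_mono ℝ (hc ▸ maxFace_subset P c)
  rw [polyDim_eq] at hF2 hdim
  have he : w - v ∈ vectorSpan ℝ F := sub_mem_vectorSpan hvw.2.2.1.1 hvw.2.1.1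
  have he0 : w - v ≠ 0 := sub_ne_zero.mpr hvw.1.symm
  obtain ⟨f, hf, hfe⟩ := exists_notMem_of_lt_finrank (L := vectorSpan ℝ F)
    (K := Submodule.span ℝ {w - v}) (by rw [finrank_span_singleton he0]; omega)
  have hspan := span_pair_eq_of_finrank_eq_two hF2 he hf he0 hfe
  obtain ⟨g, hg, hgF⟩ := exists_notMem_of_lt_finrank (L := vectorSpan ℝ P)
    (K := vectorSpan ℝ F) (by omega)
  rw [hspan] at hgF
  refine ⟨v, w, g, hvwP, fun x hx y hy hxe hye hyg => ?_⟩
  exact hP.eq_zero_of_mem_reflectionSpace hy hvwP.2.1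
    (eq_zero_of_finrank_eq_three hdim (hFP he) (hFP hf) hg he0 hfe hgF (hy.2.1 v hvwP.2.1) hye
      (hF.inner_eq_zero hP hspan hvw.2.1 hx hy hxe hye) hyg)

/-- Two adjacent odd `2`-faces of a `3`-polytope cut the reflection space down to
dimension one. -/
theorem IsOddTwoFace.exists_forall_eq_zero_of_adjacent (hP : IsPolytope P) (hdim : polyDim P = 3)
    {F₁ F₂ : Set E} (hF₁ : IsOddTwoFace P F₁) (hF₂ : IsOddTwoFace P F₂)
    (hF : IsFaceOfDim P 1 (F₁ ∩ F₂)) : ∃ v w, IsEdge P v w ∧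
      ∀ x ∈ reflectionSpace P, ∀ y ∈ reflectionSpace P, ⟪w - v, x v⟫ ≠ 0 →
        ⟪w - v, y v⟫ = 0 → y = 0 := by
  obtain ⟨⟨⟨c₁, hc₁⟩, hd₁⟩, -⟩ := id hF₁
  obtain ⟨⟨⟨c₂, hc₂⟩, hd₂⟩, -⟩ := id hF₂
  obtain ⟨⟨c, hc⟩, hd⟩ := hF
  have hGp : IsPolytope (F₁ ∩ F₂) := hc ▸ hP.isPolytope_maxFace c
  obtain ⟨v, w, hvw⟩ := hGp.exists_isEdge_of_polyDim_pos (by omega)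
  have hvwP : IsEdge P v w := hP.isEdge_of_maxFace c (hc ▸ hvw)
  have hv := hvw.2.1.1
  have hw := hvw.2.2.1.1
  have he0 : w - v ≠ 0 := sub_ne_zero.mpr hvw.1.symm
  rw [polyDim_eq] at hd₁ hd₂ hd hdim
  have hFP₁ : vectorSpan ℝ F₁ ≤ vectorSpan ℝ P := vectorSpan_mono ℝ (hc₁ ▸ maxFace_subset P c₁)
  have hFP₂ : vectorSpan ℝ F₂ ≤ vectorSpan ℝ P := vectorSpan_mono ℝ (hc₂ ▸ maxFace_subset P c₂)
  have he₁ : w - v ∈ vectorSpan ℝ F₁ := sub_mem_vectorSpan hw.1 hv.1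
  have he₂ : w - v ∈ vectorSpan ℝ F₂ := sub_mem_vectorSpan hw.2 hv.2
  obtain ⟨f₁, hf₁, hfe₁⟩ := exists_notMem_of_lt_finrank (L := vectorSpan ℝ F₁)
    (K := Submodule.span ℝ {w - v}) (by rw [finrank_span_singleton he0]; omega)
  have hspan₁ := span_pair_eq_of_finrank_eq_two hd₁ he₁ hf₁ he0 hfe₁
  have hspan : Submodule.span ℝ {w - v} = vectorSpan ℝ (F₁ ∩ F₂) := by
    apply Submodule.eq_of_le_of_finrank_le
    · rw [Submodule.span_singleton_le_iff_mem]
      exact sub_mem_vectorSpan hw hv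
    · rw [finrank_span_singleton he0, hd]
  have hex : ∃ p ∈ F₂, p - v ∉ Submodule.span ℝ {w - v} := by
    by_contra! h
    have := Submodule.finrank_mono (vectorSpan_le_of_sub_mem hv.2 h)
    rw [finrank_span_singleton he0] at this
    omega
  obtain ⟨p, hp, hpe⟩ := hex
  have hf₂ : p - v ∈ vectorSpan ℝ F₂ := sub_mem_vectorSpan hp hv.2
  have hspan₂ := span_pair_eq_of_finrank_eq_two hd₂ he₂ hf₂ he0 hpe
  -- If `p - v` were in the plane of `F₁`, then `c₁` would be as large at `p` as on `F₁`, putting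
  -- `p` in `F₁ ∩ F₂`, whose direction is that of the edge.
  have hp₁ : p - v ∉ Submodule.span ℝ {w - v, f₁} := by
    rw [← hspan₁]
    intro h
    apply hpe
    rw [hspan]
    refine sub_mem_vectorSpan ⟨?_, hp⟩ hv
    rw [hc₁] at h ⊢
    have h1 := inner_eq_zero_of_mem_vectorSpan_maxFace h
    rw [inner_sub_right, sub_eq_zero] at h1
    exact mem_maxFace_of_inner_eq (hc₁ ▸ hv.1) (hc₂ ▸ hp : p ∈ maxFace P c₂).1 h1.ge
  have hv₁ : v ∈ vertices F₁ := by
    rw [hc₁, vertices_maxFace, ← hc₁]; exact ⟨hv.1, hvwP.2.1⟩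
  have hv₂ : v ∈ vertices F₂ := by
    rw [hc₂, vertices_maxFace, ← hc₂]; exact ⟨hv.2, hvwP.2.1⟩
  refine ⟨v, w, hvwP, fun x hx y hy hxe hye => ?_⟩
  exact hP.eq_zero_of_mem_reflectionSpace hy hvwP.2.1
    (eq_zero_of_finrank_eq_three hdim (hFP₁ he₁) (hFP₁ hf₁) (hFP₂ hf₂) he0 hfe₁ hp₁
      (hy.2.1 v hvwP.2.1) hye
      (hF₁.inner_eq_zero hP hspan₁ hv₁ hx hy hxe hye)
      (hF₂.inner_eq_zero hP hspan₂ hv₂ hx hy hxe hye))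

/-- Two inscribed polytopes whose normal fan has a one-dimensional inscribed cone are
homothetic. -/
theorem NormallyEquivalent.exists_homothety {Q' : Set E} (hP : IsPolytope P)
    (hQ : IsPolytope Q) (hI : IsInscribed Q) (h : NormallyEquivalent Q P)
    (hQ' : IsPolytope Q') (hI' : IsInscribed Q') (h' : NormallyEquivalent Q' P) {v w : E}
    (hvw : IsEdge P v w)
    (hW : ∀ x ∈ reflectionSpace P, ∀ y ∈ reflectionSpace P, ⟪w - v, x v⟫ ≠ 0 →
        ⟪w - v, y v⟫ = 0 → y = 0) :
    ∃ (a : ℝ) (t : E), 0 < a ∧ Q' = (fun x => a • x + t) '' Q := by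
  obtain ⟨x, hx, z, hz⟩ := h.exists_mem_reflectionSpace hP hQ hI
  obtain ⟨y, hy, z', hz'⟩ := h'.exists_mem_reflectionSpace hP hQ' hI'
  have hne := h.inner_ne_zero hP hQ hx hz hvw
  -- Chosen so that `y - a • x` has no component along the edge.
  set a := ⟪w - v, y v⟫ / ⟪w - v, x v⟫
  have hya : y = a • x := by
    rw [← sub_eq_zero]
    refine hW x hx _ (sub_mem hy (Submodule.smul_mem _ _ hx)) hne ?_
    rw [Pi.sub_apply, Pi.smul_apply, inner_sub_right, real_inner_smul_right,
      div_mul_cancel₀ _ hne, sub_self]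
  have hmap : ∀ u ∈ vertices P, vertexMap P Q' u = a • vertexMap P Q u + (z' - a • z) :=
    fun u hu => by
      rw [hz u hu, hz' u hu, hya, Pi.smul_apply, smul_add]; abel
  refine ⟨a, z' - a • z, ?_, ?_⟩
  -- The edge factors of `Q` and `Q'` are positive and satisfy `μ' = a * μ`.
  · obtain ⟨μ, hμ, e⟩ := h.exists_vertexMap_sub hP hQ hvw
    obtain ⟨μ', hμ', e'⟩ := h'.exists_vertexMap_sub hP hQ' hvw
    rw [hmap v hvw.2.1, hmap w hvw.2.2.1, add_sub_add_right_eq_sub, ← smul_sub, e,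
      smul_smul] at e'
    have := smul_left_injective ℝ (sub_ne_zero.mpr hvw.1.symm) e'
    exact pos_of_mul_pos_left (this ▸ hμ') hμ.le
  · let f : E →ᵃ[ℝ] E := a • AffineMap.id ℝ E + AffineMap.const ℝ E (z' - a • z)
    have hf : (fun x => a • x + (z' - a • z)) = f := by ext; simp [f]
    rw [hf, ← hQ.convexHull_vertices, ← hQ'.convexHull_vertices, f.image_convexHull,
      h.vertices_eq hP hQ, h'.vertices_eq hP hQ', Set.image_image]
    congr 1
    refine Set.image_congr fun u hu => ?_
    rw [hmap u hu, ← hf]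

/-- If the support function were `⟪·, t⟫`, comparing opposite directions would make every functional
constant on `Q`, but `Q` has an edge of positive length. -/
theorem NormallyEquivalent.translationClass_ne_zero (h : NormallyEquivalent Q P)
    (hP : IsPolytope P) (hQ : IsPolytope Q) (hdim : 0 < polyDim P) :
    translationClass Q ≠ 0 := by
  intro h0
  rw [translationClass, Submodule.mkQ_apply, Submodule.Quotient.mk_eq_zero] at h0
  obtain ⟨t, ht⟩ := h0
  obtain ⟨v, w, hvw⟩ := hP.exists_isEdge_of_polyDim_pos hdim
  obtain ⟨μ, hμ, e⟩ := h.exists_vertexMap_sub hP hQ hvw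
  have hVQ : ∀ v ∈ vertices P, vertexMap P Q v ∈ Q := fun v hv =>
    vertices_subset Q (by rw [h.vertices_eq hP hQ]; exact ⟨v, hv, rfl⟩)
  have key : ∀ d, ∀ p ∈ Q, ⟪d, p⟫ ≤ ⟪d, t⟫ := fun d p hp => by
    obtain ⟨x, hx⟩ := hQ.maxFace_nonempty d
    rw [← congrFun ht d, InscribedCone.supportFun_eq hx]
    exact hx.2 p hp
  have h1 := key (w - v) _ (hVQ w hvw.2.2.1)
  have h2 := key (-(w - v)) _ (hVQ v hvw.2.1)
  rw [inner_neg_left, inner_neg_left] at h2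
  have h3 : μ * ⟪w - v, w - v⟫ = ⟪w - v, vertexMap P Q w⟫ - ⟪w - v, vertexMap P Q v⟫ := by
    rw [← inner_sub_right, e, real_inner_smul_right]
  have h4 := mul_pos hμ (real_inner_self_pos.mpr (sub_ne_zero.mpr hvw.1.symm))
  linarith

end OddFaces

/-! ### Dimension of the inscribed cone. -/

section Rank

-- With `E` in `Type`, the reflection space and `Fin k → ℝ` have ranks in the same universe.
variable {E : Type} [NormedAddCommGroup E] [InnerProductSpace ℝ E] [FiniteDimensional ℝ E]
  {P : Set E}

theorem IsPolytope.inConeDim_le (hP : IsPolytope P) {k : ℕ}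
    (L : (E → E) →ₗ[ℝ] (Fin k → ℝ)) (hL : ∀ y ∈ reflectionSpace P, L y = 0 → y = 0) :
    inConeDim P ≤ k := by
  have h1 : inConeDim P ≤ Module.rank ℝ (reflectionSpace P) :=
    (Submodule.rank_mono (Submodule.span_le.mpr hP.inCone_subset)).trans (rank_map_le _ _)
  have h2 := LinearMap.rank_le_of_injective (L ∘ₗ (reflectionSpace P).subtype)
    ((injective_iff_map_eq_zero _).mpr fun y hy => Subtype.ext (hL y y.2 hy))
  rw [rank_fin_fun] at h2
  exact h1.trans h2

theorem inConeDim_le_two (hP : IsPolytope P) (hdim : polyDim P = 3) (hI : NormallyInscribable P)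
    {F : Set E} (hF : IsOddTwoFace P F) : inConeDim P ≤ 2 := by
  obtain ⟨_, Q, hQ, hIQ, h, -⟩ := hI
  obtain ⟨x, hx, z, hz⟩ := h.exists_mem_reflectionSpace hP hQ hIQ
  obtain ⟨v, w, g, hvw, hW⟩ := hF.exists_forall_eq_zero hP hdim
  have hne := h.inner_ne_zero hP hQ hx hz hvw
  refine hP.inConeDim_le (k := 2) (LinearMap.pi fun i =>
    (innerSL ℝ (![w - v, g] i)).toLinearMap ∘ₗ LinearMap.proj v) fun y hy h0 => ?_
  exact hW x hx y hy hne (congrFun h0 0) (congrFun h0 1)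

theorem inConeDim_eq_one (hP : IsPolytope P) (hdim : 0 < polyDim P) (hI : NormallyInscribable P)
    {v w : E} (hvw : IsEdge P v w)
    (hW : ∀ x ∈ reflectionSpace P, ∀ y ∈ reflectionSpace P, ⟪w - v, x v⟫ ≠ 0 →
        ⟪w - v, y v⟫ = 0 → y = 0) : inConeDim P = 1 := by
  obtain ⟨_, Q, hQ, hIQ, h, rfl⟩ := hI
  obtain ⟨x, hx, z, hz⟩ := h.exists_mem_reflectionSpace hP hQ hIQ
  have hne := h.inner_ne_zero hP hQ hx hz hvw
  apply le_antisymm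
  · refine (hP.inConeDim_le (k := 1) (LinearMap.pi fun _ =>
      (innerSL ℝ (w - v)).toLinearMap ∘ₗ LinearMap.proj v) fun y hy h0 => ?_).trans_eq (by simp)
    exact hW x hx y hy hne (congrFun h0 0)
  · rw [Cardinal.one_le_iff_ne_zero, inConeDim, Ne, Submodule.rank_eq_zero]
    intro hbot
    refine h.translationClass_ne_zero hP hQ hdim ?_
    rw [← Submodule.mem_bot ℝ, ← hbot]
    exact Submodule.subset_span ⟨Q, hQ, hIQ, h, rfl⟩

end Rank

end InscribedCone

namespace InscribedCone

/-! ### Proper faces lie in facets. -/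

section Facets

variable {E : Type*} [NormedAddCommGroup E] [InnerProductSpace ℝ E] {P : Set E}

theorem maxFace_eq_self {c : E} (h : ∀ x ∈ vectorSpan ℝ P, ⟪c, x⟫ = 0) : maxFace P c = P := by
  refine (maxFace_subset P c).antisymm fun p hp => ⟨hp, fun q hq => ?_⟩
  have := h _ (sub_mem_vectorSpan hp hq)
  rw [inner_sub_right, sub_eq_zero] at this
  exact this.ge

variable [FiniteDimensional ℝ E]

theorem IsPolytope.exists_larger_face (hP : IsPolytope P) {c : E} (hc : maxFace P c ≠ P)
    (hdim : polyDim (maxFace P c) + 1 ≠ polyDim P) :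
    ∃ c', maxFace P c' ≠ P ∧ maxFace P c ⊆ maxFace P c' ∧
      polyDim (maxFace P c) < polyDim (maxFace P c') := by
  set L := vectorSpan ℝ (maxFace P c) with hL
  set M := vectorSpan ℝ P with hM
  set c₀ := M.starProjection c with hc₀
  have hLM : L ≤ M := vectorSpan_mono ℝ (maxFace_subset P c)
  have hinner : ∀ x ∈ M, ⟪c₀, x⟫ = ⟪c, x⟫ := fun x hx => by
    have := M.sub_starProjection_mem_orthogonal c x hx
    rw [real_inner_comm, inner_sub_left, sub_eq_zero] at this
    exact this.symm
  have hc₀0 : c₀ ≠ 0 := fun h => hc <| maxFace_eq_self fun x hx => by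
    rw [← hinner x hx, h, inner_zero_left]
  have hlt : Module.finrank ℝ L < Module.finrank ℝ M := by
    apply Submodule.finrank_lt_finrank_of_lt
    refine lt_of_le_of_ne hLM fun h => hc <| maxFace_eq_self fun x hx => ?_
    change x ∈ M at hx
    rw [← h] at hx
    exact inner_eq_zero_of_mem_vectorSpan_maxFace hx
  -- The functional `c` is tilted by some `d` orthogonal to `K`: orthogonal to `L`, it is constant
  -- on the face; orthogonal to `c₀`, it keeps the tilted functional nonconstant on `P`. Codimension
  -- at least two leaves room for `d`.
  set K := L ⊔ Submodule.span ℝ {c₀}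
  have hKM : K ≤ M := sup_le hLM <| by
    rw [Submodule.span_singleton_le_iff_mem]
    exact M.starProjection_apply_mem c
  have hK : Module.finrank ℝ K < Module.finrank ℝ M := by
    have h1 := Submodule.finrank_add_le_finrank_add_finrank L (Submodule.span ℝ {c₀})
    rw [finrank_span_singleton hc₀0] at h1
    rw [polyDim_eq, polyDim_eq] at hdim
    change Module.finrank ℝ L + 1 ≠ Module.finrank ℝ M at hdim
    change Module.finrank ℝ K ≤ _ at h1
    omega
  have hne : Kᗮ ⊓ M ≠ ⊥ := fun h => by
    have := Submodule.sup_orthogonal_inf_of_hasOrthogonalProjection hKM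
    rw [h, sup_bot_eq] at this
    rw [this] at hK
    exact hK.false
  obtain ⟨g, hg⟩ := hP.maxFace_nonempty c
  have hsign : ∃ d ∈ Kᗮ ⊓ M, ∃ p ∈ vertices P, 0 < ⟪d, p⟫ - ⟪d, g⟫ := by
    obtain ⟨d, hd, hd0⟩ := Submodule.exists_mem_ne_zero_of_ne_bot hne
    by_contra! hcon
    have h1 : ∀ p ∈ vertices P, p - g ∈ (Submodule.span ℝ {d})ᗮ := fun p hp => by
      rw [Submodule.mem_orthogonal_singleton_iff_inner_right, inner_sub_right]
      have e1 := hcon d hd p hp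
      have e2 := hcon (-d) (neg_mem hd) p hp
      rw [inner_neg_left, inner_neg_left] at e2
      linarith
    have h2 := hP.vectorSpan_le hg.1 h1 hd.2
    rw [Submodule.mem_orthogonal_singleton_iff_inner_right, inner_self_eq_zero] at h2
    exact hd0 h2
  obtain ⟨d, ⟨hdK, hdM⟩, p₀, hp₀, hp₀d⟩ := hsign
  -- The smallest ratio is the tilt at which a new vertex first ties with the face.
  obtain ⟨p, ⟨hp, hpd⟩, hmin⟩ := Set.exists_min_image
    {p | p ∈ vertices P ∧ 0 < ⟪d, p⟫ - ⟪d, g⟫}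
    (fun p => (⟪c, g⟫ - ⟪c, p⟫) / (⟪d, p⟫ - ⟪d, g⟫))
    (hP.finite_vertices.subset fun _ h => h.1) ⟨p₀, hp₀, hp₀d⟩
  set t := (⟪c, g⟫ - ⟪c, p⟫) / (⟪d, p⟫ - ⟪d, g⟫) with ht
  have ht0 : 0 ≤ t := div_nonneg (sub_nonneg.mpr (hg.2 p hp.1)) hpd.le
  have hdL : ∀ x ∈ L, ⟪d, x⟫ = 0 := fun x hx => by
    rw [real_inner_comm]; exact hdK x ((le_sup_left : L ≤ K) hx)
  have hdc : ⟪d, c₀⟫ = 0 := by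
    rw [real_inner_comm]
    exact hdK c₀ ((le_sup_right : _ ≤ K) (Submodule.mem_span_singleton_self c₀))
  have hval : ∀ q, ⟪c + t • d, q⟫ = ⟪c, q⟫ + t * ⟪d, q⟫ := fun q => by
    rw [inner_add_left, real_inner_smul_left]
  have hgm : g ∈ maxFace P (c + t • d) := hP.mem_maxFace hg.1 fun q hq => by
    rw [hval, hval]
    by_cases hqd : 0 < ⟪d, q⟫ - ⟪d, g⟫
    · have := hmin q ⟨hq, hqd⟩
      rw [le_div_iff₀ hqd] at this
      linarith
    · have := mul_nonpos_of_nonneg_of_nonpos ht0 (not_lt.mp hqd)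
      have := hg.2 q hq.1
      linarith
  have hpm : p ∈ maxFace P (c + t • d) := mem_maxFace_of_inner_eq hgm hp.1 <| by
    rw [hval, hval]
    have : t * (⟪d, p⟫ - ⟪d, g⟫) = ⟪c, g⟫ - ⟪c, p⟫ := div_mul_cancel₀ _ hpd.ne'
    linarith
  have hsub : maxFace P c ⊆ maxFace P (c + t • d) := fun q hq => by
    refine mem_maxFace_of_inner_eq hgm hq.1 ?_
    have e1 := hdL _ (sub_mem_vectorSpan hq hg)
    rw [inner_sub_right, sub_eq_zero] at e1
    rw [hval, hval, e1, inner_eq_of_mem_maxFace hq hg]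
  refine ⟨c + t • d, fun h => ?_, hsub, ?_⟩
  · have h1 : ⟪c + t • d, c₀⟫ = 0 := by
      apply inner_eq_zero_of_mem_vectorSpan_maxFace (P := P)
      rw [h]
      exact M.starProjection_apply_mem c
    rw [hval, hdc, mul_zero, add_zero, ← hinner _ (M.starProjection_apply_mem c),
      inner_self_eq_zero] at h1
    exact hc₀0 h1
  · rw [polyDim_eq, polyDim_eq]
    apply Submodule.finrank_lt_finrank_of_lt
    refine lt_of_le_of_ne (vectorSpan_mono ℝ hsub) fun h => ?_
    have h1 : p - g ∈ L := by
      rw [hL, h]; exact sub_mem_vectorSpan hpm hgm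
    have h2 := hdL _ h1
    rw [inner_sub_right] at h2
    exact hpd.ne' h2

/-- Every proper face lies in a facet. -/
theorem IsPolytope.exists_facet (hP : IsPolytope P) {c : E} (hc : maxFace P c ≠ P) :
    ∃ F, IsFacet P F ∧ maxFace P c ⊆ F := by
  induction hn : polyDim P - polyDim (maxFace P c) using Nat.strong_induction_on generalizing c with
  | _ n ih =>
    by_cases hdim : polyDim (maxFace P c) + 1 = polyDim P
    · exact ⟨_, ⟨⟨c, rfl⟩, hdim⟩, subset_rfl⟩
    obtain ⟨c', h1, h2, h3⟩ := hP.exists_larger_face hc hdim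
    have h4 : polyDim (maxFace P c') ≤ polyDim P := by
      rw [polyDim_eq, polyDim_eq]
      exact Submodule.finrank_mono (vectorSpan_mono ℝ (maxFace_subset P c'))
    obtain ⟨F, hF, hF'⟩ := ih _ (by omega) h1 rfl
    exact ⟨F, hF, h2.trans hF'⟩

end Facets

/-! ### Edges of simplices. -/

section Simplex

variable {E : Type*} [NormedAddCommGroup E] [InnerProductSpace ℝ E] {F : Set E}

theorem IsSimplex.isPolytope (hF : IsSimplex F) : IsPolytope F := by
  obtain ⟨s, hs, -, rfl⟩ := hF
  exact isPolytope_convexHull s.finite_toSet hs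

/-- The edges of a simplex at one of its vertices are linearly independent. -/
theorem IsSimplex.linearIndependent (hF : IsSimplex F) {v : E} (hv : v ∈ vertices F) :
    LinearIndependent ℝ fun p : {p // p ∈ vertices F ∧ p ≠ v} => (p : E) - v := by
  obtain ⟨s, -, hs, rfl⟩ := hF
  have hsub : vertices (convexHull ℝ (s : Set E)) ⊆ s := extremePoints_convexHull_subset
  have h := (affineIndependent_iff_linearIndependent_vsub ℝ _ (⟨v, hsub hv⟩ : s)).mp hs
  exact h.comp (fun p : {p // p ∈ vertices (convexHull ℝ (s : Set E)) ∧ p ≠ v} =>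
    (⟨⟨p, hsub p.2.1⟩, fun e => p.2.2 (congrArg Subtype.val e)⟩ : {x : s // x ≠ ⟨v, hsub hv⟩}))
    fun p q e => Subtype.ext (congrArg (fun x => (x.1 : E)) e)

variable [FiniteDimensional ℝ E]

theorem exists_inner_eq_of_linearIndependent {ι : Type*} {b : ι → E}
    (hb : LinearIndependent ℝ b) (g : ι → ℝ) : ∃ d : E, ∀ i, ⟪d, b i⟫ = g i := by
  obtain ⟨f, hf⟩ := LinearMap.exists_extend ((Module.Basis.span hb).constr ℝ g)
  refine ⟨(InnerProductSpace.toDual ℝ E).symm (LinearMap.toContinuousLinearMap f), fun i => ?_⟩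
  rw [InnerProductSpace.toDual_symm_apply]
  have h1 := congrArg (fun k => k (Module.Basis.span hb i)) hf
  rw [Module.Basis.constr_basis, LinearMap.comp_apply, Submodule.subtype_apply,
    Module.Basis.span_apply] at h1
  exact h1

theorem IsSimplex.eq_zero_of_smul_eq (hF : IsSimplex F) {v p q : E} (hv : v ∈ vertices F)
    (hp : p ∈ vertices F) (hq : q ∈ vertices F) (hpv : p ≠ v) (hqv : q ≠ v) (hpq : p ≠ q)
    {α β : ℝ} (h : α • (p - v) = β • (q - v)) : α = 0 ∧ β = 0 := by
  classical
  obtain ⟨d, hd⟩ := exists_inner_eq_of_linearIndependent (hF.linearIndependent hv)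
    (fun x => if (x : E) = p then 1 else 0)
  have h1 := hd ⟨p, hp, hpv⟩
  have h2 := hd ⟨q, hq, hqv⟩
  simp only [if_true, hpq.symm, if_false] at h1 h2
  have h3 := congrArg (fun x => ⟪d, x⟫) h
  simp only [real_inner_smul_right, h1, h2, mul_one, mul_zero] at h3
  rw [h3, zero_smul, eq_comm, smul_eq_zero] at h
  exact ⟨h3, h.resolve_right (sub_ne_zero.mpr hqv)⟩

theorem IsSimplex.isEdge (hF : IsSimplex F) {v w : E} (hv : v ∈ vertices F)
    (hw : w ∈ vertices F) (hvw : v ≠ w) : IsEdge F v w := by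
  classical
  -- Independence of the edges at `v` allows a functional that ties `v` with `w` and is smaller by
  -- one at every other vertex.
  obtain ⟨d, hd⟩ := exists_inner_eq_of_linearIndependent (hF.linearIndependent hv)
    (fun p => if (p : E) = w then 0 else -1)
  have hd' : ∀ p ∈ vertices F, p ≠ v → ⟪d, p⟫ - ⟪d, v⟫ = if p = w then 0 else -1 :=
    fun p hp hpv => by
      rw [← inner_sub_right]; exact hd ⟨p, hp, hpv⟩
  have hm : v ∈ maxFace F d := hF.isPolytope.mem_maxFace hv.1 fun p hp => by
    by_cases e : p = v
    · rw [e]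
    have := hd' p hp e
    split_ifs at this <;> linarith
  refine ⟨hvw, hv, hw, d, hF.isPolytope.maxFace_eq ?_⟩
  ext p
  simp only [Set.mem_inter_iff, Set.mem_insert_iff, Set.mem_singleton_iff]
  constructor
  · rintro ⟨h1, h2⟩
    by_contra! h
    have := hd' p h2 h.1
    rw [if_neg h.2, inner_eq_of_mem_maxFace h1 hm] at this
    linarith
  · rintro (rfl | rfl)
    · exact ⟨hm, hv⟩
    · have := hd' p hw hvw.symm
      rw [if_pos rfl] at this
      exact ⟨mem_maxFace_of_inner_eq hm hw.1 (by linarith), hw⟩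

end Simplex

/-! ### Rigidity of simplicial polytopes. -/

section Simplicial

variable {E : Type*} [NormedAddCommGroup E] [InnerProductSpace ℝ E] {P Q : Set E}

/-- The edges at a vertex give vertices of the vertex figure. -/
theorem IsEdge.figurePoint_mem_vertices (hP : IsPolytope P) {b v w : E} (hb : maxFace P b = {v})
    (hvw : IsEdge P v w) : figurePoint b v w ∈ vertices (vertexFigure P b v) := by
  obtain ⟨hne, hv, hw, c, hc⟩ := hvw
  have hN := hP.isPolytope_vertexFigure b hw hne.symm
  have hvc : v ∈ maxFace P c := hc ▸ subset_convexHull ℝ _ (by simp)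
  have hwc : w ∈ maxFace P c := hc ▸ subset_convexHull ℝ _ (by simp)
  have hlift : ∀ p ∈ vertices P, p ≠ v →
      ⟪c, p⟫ - ⟪c, v⟫ = ⟪b, v - p⟫ * ⟪c, figurePoint b v p⟫ := fun p hp hpv => by
    have := inner_lift (f := c) (m := 0) hb hp hpv
    rwa [zero_smul, add_zero, sub_zero] at this
  -- A vertex of the figure maximizing `c` comes from a vertex of the edge other than `v`, so it is
  -- the point of `w`.
  obtain ⟨q, hq⟩ := (hN.isPolytope_maxFace c).vertices_nonempty
  rw [vertices_maxFace] at hq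
  obtain ⟨p, hp, hpv, rfl⟩ := exists_figurePoint_eq hq.2
  have h1 := hlift w hw hne.symm
  rw [inner_eq_of_mem_maxFace hwc hvc, sub_self, eq_comm, mul_eq_zero] at h1
  have h2 := h1.resolve_left (inner_sub_pos_of_maxFace_eq hb hw hne.symm).ne'
  have h3 := hq.1.2 _ (figurePoint_mem hw hne.symm)
  rw [h2] at h3
  have h4 := hlift p hp hpv
  have h5 := mul_nonneg (inner_sub_pos_of_maxFace_eq hb hp hpv).le h3
  have h6 : p ∈ maxFace P c ∩ vertices P :=
    ⟨mem_maxFace_of_inner_eq hvc hp.1 (by linarith), hp⟩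
  rw [← vertices_maxFace, hc] at h6
  rcases extremePoints_convexHull_subset h6 with h | h
  · exact absurd h hpv
  · rw [← Set.mem_singleton_iff.mp h]; exact hq.2

variable [FiniteDimensional ℝ E]

/-- Edges at `v` adjacent in the vertex figure span a triangle inside a simplex facet, which forces
equal factors; the graph of the vertex figure connects all edges at `v`. -/
theorem IsSimplicial.exists_forall_vertexMap_sub (hs : IsSimplicial P) (hP : IsPolytope P)
    (hdim : 3 ≤ polyDim P) (hQ : IsPolytope Q) (h : NormallyEquivalent Q P) {v : E}
    (hv : v ∈ vertices P) : ∃ l : ℝ, ∀ w, IsEdge P v w →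
      vertexMap P Q w - vertexMap P Q v = l • (w - v) := by
  classical
  by_cases hex : ∃ w, IsEdge P v w
  swap
  · exact ⟨0, fun w hw => absurd ⟨w, hw⟩ hex⟩
  obtain ⟨w₀, hw₀⟩ := hex
  obtain ⟨b, hb⟩ := hP.exists_maxFace_eq_singleton hv
  have hN := hP.isPolytope_vertexFigure b hw₀.2.2.1 hw₀.1.symm
  obtain ⟨l, -, hl⟩ := h.exists_vertexMap_sub hP hQ hw₀
  refine ⟨l, fun w hw => hN.induction_on_edges
    (S := fun q => ∀ w ∈ vertices P, w ≠ v → figurePoint b v w = q →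
      vertexMap P Q w - vertexMap P Q v = l • (w - v))
    (hw₀.figurePoint_mem_vertices hP hb) ?_ ?_ (hw.figurePoint_mem_vertices hP hb)
    w hw.2.2.1 hw.1.symm rfl⟩
  · intro w hw hwv e
    rw [figurePoint_injOn hb ⟨hw, hwv⟩ ⟨hw₀.2.2.1, hw₀.1.symm⟩ e]
    exact hl
  rintro q q' ⟨hqq, hq, hq', f, hf⟩ hS w hw hwv rfl
  obtain ⟨a, ha, hav, rfl⟩ := exists_figurePoint_eq hq
  have haw : a ≠ w := fun e => hqq (by rw [e])
  have hla := hS a ha hav rfl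
  set N := vertexFigure P b v
  have haf : figurePoint b v a ∈ maxFace N f := hf ▸ subset_convexHull ℝ _ (by simp)
  have hwf : figurePoint b v w ∈ maxFace N f := hf ▸ subset_convexHull ℝ _ (by simp)
  have hlift := hP.maxFace_lift hb haf
  set c := f + ⟪f, figurePoint b v a⟫ • b
  -- Otherwise two figure points would span the directions of `P`, which has dimension at least
  -- three.
  have hproper : maxFace P c ≠ P := fun hcP => by
    rw [hcP, Set.inter_eq_right.mpr (vertices_subset P)] at hlift
    have hle : vectorSpan ℝ P ≤ Submodule.span ℝ {figurePoint b v a, figurePoint b v w} := by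
      refine hP.vectorSpan_le hv.1 fun p hp => ?_
      by_cases hpv : p = v
      · rw [hpv, sub_self]; exact zero_mem _
      rw [← smul_figurePoint hb hp hpv]
      apply Submodule.smul_mem
      have hp' := hp
      rw [hlift] at hp'
      have := (hp'.resolve_left hpv).2.2
      rw [hf] at this
      exact convexHull_min Submodule.subset_span (Submodule.convex _) this
    have h1 := Submodule.finrank_mono hle
    have h2 := finrank_span_finset_le_card (R := ℝ) {figurePoint b v a, figurePoint b v w}
    rw [Finset.coe_pair, Set.finrank] at h2
    have h3 := Finset.card_le_two (a := figurePoint b v a) (b := figurePoint b v w)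
    rw [polyDim_eq] at hdim
    omega
  obtain ⟨F, hF, hcF⟩ := hP.exists_facet hproper
  have hsF := hs F hF
  obtain ⟨⟨c', rfl⟩, -⟩ := hF
  have hmem : ∀ p, p ∈ maxFace P c ∩ vertices P → p ∈ vertices (maxFace P c') := fun p hp => by
    rw [vertices_maxFace]; exact ⟨hcF hp.1, hp.2⟩
  have hvF := hmem v (by rw [hlift]; exact Or.inl rfl)
  have haF := hmem a (by rw [hlift]; exact Or.inr ⟨ha, hav, haf⟩)
  have hwF := hmem w (by rw [hlift]; exact Or.inr ⟨hw, hwv, hwf⟩)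
  obtain ⟨m, -, hm⟩ := h.exists_vertexMap_sub hP hQ
    (hP.isEdge_of_maxFace c' (hsF.isEdge hvF hwF hwv.symm))
  obtain ⟨k, -, hk⟩ := h.exists_vertexMap_sub hP hQ
    (hP.isEdge_of_maxFace c' (hsF.isEdge haF hwF haw))
  -- The sides of the triangle `v`, `a`, `w` scale by `l`, `m`, `k`; closing up the image triangle
  -- and independence of two sides give `k = m = l`.
  have e : (k - m) • (w - v) = (k - l) • (a - v) := by
    have e1 : k • (w - a) = m • (w - v) - l • (a - v) := by
      rw [← hk, ← hm, ← hla]; abel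
    rw [← sub_eq_zero] at e1 ⊢
    rw [← e1]
    module
  obtain ⟨e1, e2⟩ := hsF.eq_zero_of_smul_eq hvF hwF haF hwv hav haw.symm e
  rw [hm, ← sub_eq_zero.mp e1, sub_eq_zero.mp e2]

/-- The factors at the two ends of an edge both scale that edge, so they agree, and connectedness
makes the factor global. -/
theorem IsSimplicial.exists_vertexMap_eq (hs : IsSimplicial P) (hP : IsPolytope P)
    (hdim : 3 ≤ polyDim P) (hQ : IsPolytope Q) (h : NormallyEquivalent Q P) :
    ∃ (l : ℝ) (t : E), ∀ v ∈ vertices P, vertexMap P Q v = l • v + t := by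
  have hloc := fun v hv => hs.exists_forall_vertexMap_sub hP hdim hQ h (v := v) hv
  choose! l hl using hloc
  obtain ⟨v₀, hv₀⟩ := hP.vertices_nonempty
  refine ⟨l v₀, vertexMap P Q v₀ - l v₀ • v₀, fun v hv => ?_⟩
  refine (hP.induction_on_edges (S := fun v => (∀ w, IsEdge P v w →
    vertexMap P Q w - vertexMap P Q v = l v₀ • (w - v)) ∧
    vertexMap P Q v = l v₀ • v + (vertexMap P Q v₀ - l v₀ • v₀)) hv₀ ⟨hl v₀ hv₀, by abel⟩ ?_ hv).2
  rintro v w hvw ⟨h1, h2⟩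
  have h3 := h1 w hvw
  have h4 := hl w hvw.2.2.1 v hvw.symm
  have h5 : l w = l v₀ := by
    rw [← neg_sub (vertexMap P Q w), h3, ← neg_sub w v, smul_neg, neg_inj] at h4
    exact (smul_left_injective ℝ (sub_ne_zero.mpr hvw.1.symm) h4).symm
  refine ⟨fun u hu => h5 ▸ hl w hvw.2.2.1 u hu, ?_⟩
  rw [sub_eq_iff_eq_add.mp h3, h2, smul_sub]
  abel

theorem IsSimplicial.inCone_subset (hs : IsSimplicial P) (hP : IsPolytope P)
    (hdim : 3 ≤ polyDim P) : inCone P ⊆ Submodule.span ℝ {translationClass P} := by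
  rintro _ ⟨Q, hQ, -, h, rfl⟩
  obtain ⟨l, t, hlt⟩ := hs.exists_vertexMap_eq hP hdim hQ h
  rw [SetLike.mem_coe, Submodule.mem_span_singleton]
  refine ⟨l, ?_⟩
  rw [translationClass, translationClass, ← map_smul, Submodule.mkQ_apply, Submodule.mkQ_apply,
    Submodule.Quotient.eq]
  refine ⟨-t, ?_⟩
  ext c
  simp [h.supportFun_eq hP hQ, hlt _ (hP.topVertex_mem c).2, inner_add_right,
    supportFun_eq (hP.topVertex_mem c).1, real_inner_smul_right]

theorem IsSimplicial.inConeDim_le_one (hs : IsSimplicial P) (hP : IsPolytope P)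
    (hdim : 3 ≤ polyDim P) : inConeDim P ≤ 1 :=
  (Submodule.rank_mono (Submodule.span_le.mpr (hs.inCone_subset hP hdim))).trans
    ((rank_span_le _).trans (by simp))

end Simplicial

end InscribedCone

theorem mainTheorem10 (n : ℕ) :
    (∀ (d : ℕ) (P : Set (EuclideanSpace ℝ (Fin n))), 3 ≤ d → IsPolytope P → polyDim P = d →
      IsSimplicial P → inConeDim P ≤ 1) ∧
    (∀ P : Set (EuclideanSpace ℝ (Fin n)), IsPolytope P → polyDim P = 3 →
      NormallyInscribable P →
      ((∃ F, IsOddTwoFace P F) → inConeDim P ≤ 2) ∧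
      ((∃ F₁ F₂, IsOddTwoFace P F₁ ∧ IsOddTwoFace P F₂ ∧ IsFaceOfDim P 1 (F₁ ∩ F₂)) →
        inConeDim P = 1 ∧
        ∀ Q Q' : Set (EuclideanSpace ℝ (Fin n)),
          IsPolytope Q → IsInscribed Q → normalFan Q = normalFan P →
          IsPolytope Q' → IsInscribed Q' → normalFan Q' = normalFan P →
          ∃ (a : ℝ) (t : EuclideanSpace ℝ (Fin n)), 0 < a ∧ Q' = (fun x => a • x + t) '' Q)) := by
  refine ⟨fun d P hd hP hdim hs => hs.inConeDim_le_one hP (hdim ▸ hd), fun P hP hdim hI => ⟨?_, ?_⟩⟩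
  · rintro ⟨F, hF⟩
    exact inConeDim_le_two hP hdim hI hF
  · rintro ⟨F₁, F₂, hF₁, hF₂, hF⟩
    obtain ⟨v, w, hvw, hW⟩ := hF₁.exists_forall_eq_zero_of_adjacent hP hdim hF₂ hF
    refine ⟨inConeDim_eq_one hP (by omega) hI hvw hW, fun Q Q' hQ hIQ hN hQ' hIQ' hN' => ?_⟩
    exact (hP.normallyEquivalent_of_normalFan_eq hQ hN).exists_homothety hP hQ hIQ hQ' hIQ'
      (hP.normallyEquivalent_of_normalFan_eq hQ' hN') hvw hW
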